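/- Let $m\ge 1$, $\alpha_1<\cdots<\alpha_m$ and $\beta_1,\dots,\beta_m$ be real numbers and $\boldsymbol n=(n_1,\dots,n_m)$ a vector of non-negative integers. For $1\le i\le m$ put $$f_i(w)=e^{-\frac13w^3+\alpha_iw^2+\beta_iw},\qquad F_1=f_1,\qquad F_i=f_i/f_{i-1}\ (i\ge 2).$$ For vectors $W,\tilde W\in\mathbb C^N$ let $\mathrm C(W;\tilde W)=\det\big[\tfrac1{w_i-\tilde w_j}\big]_{i,j=1}^N$ (equal to $1$ if $N=0$), and let $W\sqcup W'$ denote concatenation of vectors. *Contours.* For $0<\theta<\pi$, a contour from $\infty e^{-i\theta}$ to $\infty e^{i\theta}$ is a continuous curve $\gamma:\mathbb R\to\mathbb C$, $C^1$ near every point outside a finite set of parameters, with $|\gamma(t)|\to\infty$ as $t\to\pm\infty$, $\gamma(t)/|\gamma(t)|\to e^{\pm i\theta}$ as $t\to\pm\infty$, and $\int_\gamma e^{-c|w|}|dw|<\infty$ for every $c>0$. A contour $\gamma$ is to the left of $\gamma'$ if the two are at a positive distance, every point of $\gamma'$ can be joined to all sufficiently large positive reals by a path avoiding $\gamma$, and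 every point of $\gamma$ can be joined to all sufficiently large negative reals by a path avoiding $\gamma'$. Let $\Gamma_{m,\mathrm L}^{\rm in},\dots,\Gamma_{2,\mathrm L}^{\rm in},\Gamma_{1,\mathrm L},\Gamma_{2,\mathrm L}^{\rm out},\dots,\Gamma_{m,\mathrm L}^{\rm out}$ be contours from $\infty e^{-2\pi i/3}$ to $\infty e^{2\pi i/3}$ in $\{\Re w<0\}$, ordered from left to right, and let $\Gamma_{m,\mathrm R}^{\rm in},\dots,\Gamma_{2,\mathrm R}^{\rm in},\Gamma_{1,\mathrm R},\Gamma_{2,\mathrm R}^{\rm out},\dots,\Gamma_{m,\mathrm R}^{\rm out}$ be contours from $\infty e^{-\pi i/5}$ to $\infty e^{\pi i/5}$ in $\{\Re w>0\}$, ordered from right to left. Put $\Gamma_{1,\mathrm L}^{\rm in}=\Gamma_{1,\mathrm L}$ and $\Gamma_{1,\mathrm R}^{\rm out}=\Gamma_{1,\mathrm R}$. *The function $\hat{\mathcal D}_{\boldsymbol n}$.* Write $U^{(i)}=(u^{(i)}_1,\dots,u^{(i)}_{n_i})$ and $V^{(i)}=(v^{(i)}_1,\dots,v^{(i)}_{n_i})$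 for $1\le i\le m$, let $U^{(m+1)},V^{(m+1)}$ be empty, and let $$I(u,v)=\mathrm C(V^{(1)};U^{(1)})\prod_{i=1}^m\mathrm C(U^{(i)}\sqcup V^{(i+1)};V^{(i)}\sqcup U^{(i+1)})\prod_{i=1}^m\prod_{\ell_i=1}^{n_i}\frac{F_i(u^{(i)}_{\ell_i})}{F_i(v^{(i)}_{\ell_i})}.$$ For $\boldsymbol z=(z_1,\dots,z_{m-1})$ put $$\begin{aligned}\mathcal D_{\boldsymbol n}(\boldsymbol z)=&\prod_{i=1}^{m-1}(1-z_i)^{n_i}(1-z_i^{-1})^{n_{i+1}}\\ &\cdot\prod_{i=2}^m\prod_{\ell_i=1}^{n_i}\Big(\tfrac1{1-z_{i-1}}\int_{\Gamma_{i,\mathrm L}^{\rm in}}\tfrac{du^{(i)}_{\ell_i}}{2\pi i}-\tfrac{z_{i-1}}{1-z_{i-1}}\int_{\Gamma_{i,\mathrm L}^{\rm out}}\tfrac{du^{(i)}_{\ell_i}}{2\pi i}\Big)\prod_{\ell_1=1}^{n_1}\int_{\Gamma_{1,\mathrm L}}\tfrac{du^{(1)}_{\ell_1}}{2\pi i}\\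 &\cdot\prod_{i=2}^m\prod_{\ell_i=1}^{n_i}\Big(\tfrac1{1-z_{i-1}}\int_{\Gamma_{i,\mathrm R}^{\rm in}}\tfrac{dv^{(i)}_{\ell_i}}{2\pi i}-\tfrac{z_{i-1}}{1-z_{i-1}}\int_{\Gamma_{i,\mathrm R}^{\rm out}}\tfrac{dv^{(i)}_{\ell_i}}{2\pi i}\Big)\prod_{\ell_1=1}^{n_1}\int_{\Gamma_{1,\mathrm R}}\tfrac{dv^{(1)}_{\ell_1}}{2\pi i}\; I(u,v),\end{aligned}$$ where the product of linear combinations of integrals is expanded multilinearly (in $\frac{1}{2\pi i}$ the letter $i$ is the imaginary unit), and $$\hat{\mathcal D}_{\boldsymbol n}=\oint_0\cdots\oint_0\mathcal D_{\boldsymbol n}(\boldsymbol z)\prod_{i=1}^{m-1}\frac{dz_i}{2\pi i\,z_i(1-z_i)},$$ where $z_i$ runs counterclockwise over a circle $|z_i|=r_i$ with $0<r_i<1$. **Lemma.** For every choice of the contours and of the radii $r_i\in(0,1)$, all the integrals above and below converge absolutely, and the following holds. (i) $$\hat{\mathcal D}_{\boldsymbol n}=\prod_{i=1}^m\prod_{\ell_i=1}^{n_i}\Big(\int_{\Gamma_{i,\mathrm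 L}^{\rm in}}\frac{du^{(i)}_{\ell_i}}{2\pi i}\int_{\Gamma_{i,\mathrm R}^{\rm out}}\frac{dv^{(i)}_{\ell_i}}{2\pi i}\Big)\,I(u,v).$$ (ii) If $n_1\ge\cdots\ge n_m$, then, with $n_{m+1}=0$, $k_i=n_i-n_{i+1}$ and $\hat V^{(i)}=(\hat v^{(i)}_1,\dots,\hat v^{(i)}_{k_i})$ for $1\le i\le m$, $$\begin{aligned}\hat{\mathcal D}_{\boldsymbol n}=&\prod_{i=1}^{m-1}\frac{n_i!}{k_i!}\;\prod_{i=1}^m\prod_{\ell_i=1}^{n_i}\int_{\Gamma_{i,\mathrm L}^{\rm in}}\frac{du^{(i)}_{\ell_i}}{2\pi i}\;\prod_{i=1}^m\prod_{\hat\ell_i=1}^{k_i}\int_{\Gamma_{1,\mathrm R}}\frac{d\hat v^{(i)}_{\hat\ell_i}}{2\pi i}\\ &\mathrm C(\hat V^{(m)}\sqcup\cdots\sqcup\hat V^{(1)};U^{(1)})\cdot\prod_{i=1}^m\mathrm C(U^{(i)};U^{(i+1)}\sqcup\hat V^{(i)})\cdot\prod_{i=1}^m\frac{\prod_{\ell_i=1}^{n_i}F_i(u^{(i)}_{\ell_i})}{\prod_{\hat\ell_i=1}^{k_i}f_i(\hat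 v^{(i)}_{\hat\ell_i})}.\end{aligned}$$ For all other $\boldsymbol n$, $\hat{\mathcal D}_{\boldsymbol n}=0$. -/

import Mathlib

noncomputable section

namespace AiryD

/-! ### Contours -/

/-- `γ` is a parametrized piecewise `C¹` contour going from `∞ e^{-iθ}` to `∞ e^{iθ}`.
The last field is the (parametrization independent) finiteness of `∫_γ e^{-c|w|} |dw|` for every
`c > 0`: the length of the part of the contour in a large disc does not grow exponentially. -/
structure IsContour (θ : ℝ) (γ : ℝ → ℂ) : Prop where
  continuous : Continuous γ
  piecewise : ∃ S : Finset ℝ, ∀ t, t ∉ S → ContDiffAt ℝ 1 γ t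
  norm_atTop : Filter.Tendsto (fun t => ‖γ t‖) Filter.atTop Filter.atTop
  norm_atBot : Filter.Tendsto (fun t => ‖γ t‖) Filter.atBot Filter.atTop
  dir_atTop : Filter.Tendsto (fun t => γ t / (‖γ t‖ : ℂ)) Filter.atTop
    (nhds (Complex.exp (θ * Complex.I)))
  dir_atBot : Filter.Tendsto (fun t => γ t / (‖γ t‖ : ℂ)) Filter.atBot
    (nhds (Complex.exp (-θ * Complex.I)))
  length : ∀ c : ℝ, 0 < c →
    MeasureTheory.Integrable (fun t => ‖deriv γ t‖ * Real.exp (-c * ‖γ t‖))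

/-- The point `a` lies to the right of `γ`: off `γ`, it can be joined to all large positive
reals. -/
def OnRight (γ : ℝ → ℂ) (a : ℂ) : Prop :=
  ∀ᶠ x : ℝ in Filter.atTop, JoinedIn (Set.range γ)ᶜ a (x : ℂ)

/-- The point `a` lies to the left of `γ`: off `γ`, it can be joined to all large negative
reals. -/
def OnLeft (γ : ℝ → ℂ) (a : ℂ) : Prop :=
  ∀ᶠ x : ℝ in Filter.atBot, JoinedIn (Set.range γ)ᶜ a (x : ℂ)

/-- The contour `γ` lies to the left of the contour `γ'`, at a positive distance. -/
structure StrictlyLeft (γ γ' : ℝ → ℂ) : Prop where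
  right : ∀ t, OnRight γ (γ' t)
  left : ∀ t, OnLeft γ' (γ t)
  separated : ∃ δ : ℝ, 0 < δ ∧ ∀ s t, δ ≤ ‖γ s - γ' t‖

/-- The `4m - 2` contours, where `m = M + 1`.  The contours `L 0, …, L (2M)` are
`Γ_{m,L}^in, …, Γ_{2,L}^in, Γ_{1,L}, Γ_{2,L}^out, …, Γ_{m,L}^out`, ordered from left to right in the
left half plane, and `R 0, …, R (2M)` are
`Γ_{m,R}^in, …, Γ_{2,R}^in, Γ_{1,R}, Γ_{2,R}^out, …, Γ_{m,R}^out`, ordered from right to left in the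
right half plane. -/
structure ContourSystem (M : ℕ) where
  L : Fin (2 * M + 1) → ℝ → ℂ
  R : Fin (2 * M + 1) → ℝ → ℂ
  isContour_L : ∀ p, IsContour (2 * Real.pi / 3) (L p)
  isContour_R : ∀ p, IsContour (Real.pi / 5) (R p)
  re_L : ∀ p t, (L p t).re < 0
  re_R : ∀ p t, 0 < (R p t).re
  order_L : ∀ p q, p < q → StrictlyLeft (L p) (L q)
  order_R : ∀ p q, p < q → StrictlyLeft (R q) (R p)

/-- Position, in the lists above, of the level `i` contour with superscript `in` (`b = true`) or
`out` (`b = false`).  Levels are counted from `0`: level `i` carries the index `i + 1` of the formulas; at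
level `0` both superscripts denote the middle contour. -/
def pos {M : ℕ} (b : Bool) (i : Fin (M + 1)) : Fin (2 * M + 1) :=
  if b then ⟨M - i, by omega⟩ else ⟨M + i, by omega⟩

/-- `Γ_{i,L}^in` (`b = true`) or `Γ_{i,L}^out` (`b = false`). -/
def ContourSystem.left {M : ℕ} (Γ : ContourSystem M) (b : Bool) (i : Fin (M + 1)) : ℝ → ℂ :=
  Γ.L (pos b i)

/-- `Γ_{i,R}^in` (`b = true`) or `Γ_{i,R}^out` (`b = false`). -/
def ContourSystem.right {M : ℕ} (Γ : ContourSystem M) (b : Bool) (i : Fin (M + 1)) : ℝ → ℂ :=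
  Γ.R (pos b i)

/-- The function on parameter space whose integral is the multiple contour integral
`∏_k ∫_{γ_k} dw_k / (2πi)  g(w)`. -/
def pulledBack {ι : Type} [Fintype ι] (γ : ι → ℝ → ℂ) (g : (ι → ℂ) → ℂ) (t : ι → ℝ) : ℂ :=
  g (fun k => γ k (t k)) * ∏ k, (deriv (γ k) (t k) / (2 * Real.pi * Complex.I))

/-- The multiple contour integral `∏_k ∫_{γ_k} dw_k / (2πi)  g(w)`. -/
def contourInt {ι : Type} [Fintype ι] (γ : ι → ℝ → ℂ) (g : (ι → ℂ) → ℂ) : ℂ :=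
  ∫ t : ι → ℝ, pulledBack γ g t

/-- Absolute convergence of the multiple contour integral. -/
def ContourIntegrable {ι : Type} [Fintype ι] (γ : ι → ℝ → ℂ) (g : (ι → ℂ) → ℂ) : Prop :=
  MeasureTheory.Integrable (pulledBack γ g)

/-! ### The integrand -/

/-- `f_i(w) = exp(-τ_i w³/3 + α_i w² + β_i w)`. -/
def f {M : ℕ} (τ α β : Fin (M + 1) → ℝ) (i : Fin (M + 1)) (w : ℂ) : ℂ :=
  Complex.exp (-(1 / 3) * τ i * w ^ 3 + α i * w ^ 2 + β i * w)

/-- `F_1 = f_1` and `F_i = f_i / f_{i-1}` for `i ≥ 2`. -/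
def F {M : ℕ} (τ α β : Fin (M + 1) → ℝ) (i : Fin (M + 1)) (w : ℂ) : ℂ :=
  Fin.cases (motive := fun _ => ℂ) (f τ α β 0 w)
    (fun j : Fin M => f τ α β j.succ w / f τ α β j.castSucc w) i

/-- The Cauchy determinant `C(W; W') = det [1 / (w_i - w'_j)]` of two vectors of the same
dimension. -/
def cauchyDet {p q : ℕ} (W : Fin p → ℂ) (W' : Fin q → ℂ) (h : p = q) : ℂ :=
  Matrix.det (Matrix.of fun i j : Fin p => 1 / (W i - W' (Fin.cast h j)))

/-- Indices `(i, ℓ_i)`, `1 ≤ ℓ_i ≤ n_i`, of the variables `u^{(i)}_{ℓ_i}`. -/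
abbrev Var {M : ℕ} (n : Fin (M + 1) → ℕ) : Type := Σ i : Fin (M + 1), Fin (n i)

/-- The vector `U^{(i)} = (u^{(i)}_1, …, u^{(i)}_{n_i})`. -/
def vec {M : ℕ} {n : Fin (M + 1) → ℕ} (u : Var n → ℂ) (i : Fin (M + 1)) : Fin (n i) → ℂ :=
  fun l => u ⟨i, l⟩

/-- The integrand
`C(V¹; U¹) ∏_{i=1}^m C(Uⁱ ⊔ Vⁱ⁺¹; Vⁱ ⊔ Uⁱ⁺¹) ∏_{i,ℓ} F_i(uⁱ_ℓ) / F_i(vⁱ_ℓ)`,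
in the variables `w = (u, v)`.  As `U^{(m+1)}`, `V^{(m+1)}` are empty, the factor `i = m` is
`C(U^{(m)}; V^{(m)})`. -/
def integrand {M : ℕ} (τ α β : Fin (M + 1) → ℝ) (n : Fin (M + 1) → ℕ)
    (w : Var n ⊕ Var n → ℂ) : ℂ :=
  let U := vec (fun k : Var n => w (Sum.inl k))
  let V := vec (fun k : Var n => w (Sum.inr k))
  cauchyDet (V 0) (U 0) rfl *
    ((∏ i : Fin M, cauchyDet (Fin.append (U i.castSucc) (V i.succ))
        (Fin.append (V i.castSucc) (U i.succ)) rfl) *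
      cauchyDet (U (Fin.last M)) (V (Fin.last M)) rfl) *
    ∏ k : Var n, F τ α β k.1 (w (Sum.inl k)) / F τ α β k.1 (w (Sum.inr k))

/-! ### The functions `𝒟_n` and `𝒟̂_n` -/

/-- The coefficient of the `in` (`b = true`) or `out` (`b = false`) contour at level `i`:
`1 / (1 - z_{i-1})` and `- z_{i-1} / (1 - z_{i-1})` for `i ≥ 2`; at `i = 1` there is only one
contour, with coefficient `1` (indices counted from `1` in this comment). -/
def weight {M : ℕ} (z : Fin M → ℂ) (b : Bool) (i : Fin (M + 1)) : ℂ :=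
  Fin.cases (motive := fun _ => ℂ) (if b then 1 else 0)
    (fun j : Fin M => if b then 1 / (1 - z j) else -(z j / (1 - z j))) i

/-- The contours of the variables `(u, v)` when `a`, `b` choose `in` (`true`) or `out` (`false`)
for each of them. -/
def ContourSystem.choice {M : ℕ} (Γ : ContourSystem M) {n : Fin (M + 1) → ℕ}
    (a b : Var n → Bool) : Var n ⊕ Var n → ℝ → ℂ :=
  Sum.elim (fun k => Γ.left (a k) k.1) (fun k => Γ.right (b k) k.1)

/-- `𝒟_n(z)`.  The product of the linear combinations of integrals over `in` and `out` contours
is, by definition, expanded into the sum over all choices of one contour for each variable. -/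
def D {M : ℕ} (Γ : ContourSystem M) (τ α β : Fin (M + 1) → ℝ) (n : Fin (M + 1) → ℕ)
    (z : Fin M → ℂ) : ℂ :=
  (∏ i : Fin M, (1 - z i) ^ n i.castSucc * (1 - (z i)⁻¹) ^ n i.succ) *
    ∑ a : Var n → Bool, ∑ b : Var n → Bool,
      (∏ k, weight z (a k) k.1) * (∏ k, weight z (b k) k.1) *
        contourInt (Γ.choice a b) (integrand τ α β n)

/-- The integrand of the `z`-integrals, all `τ_i` being `1`. -/
def zIntegrand {M : ℕ} (Γ : ContourSystem M) (α β : Fin (M + 1) → ℝ) (n : Fin (M + 1) → ℕ)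
    (z : Fin M → ℂ) : ℂ :=
  D Γ (fun _ => 1) α β n z * ∏ i : Fin M, 1 / (2 * Real.pi * Complex.I * z i * (1 - z i))

/-- `𝒟̂_n = ∮_0 ⋯ ∮_0 𝒟_n(z) ∏ dz_i / (2πi z_i (1 - z_i))`, where `z_i` runs over the circle
`|z_i| = r_i` counterclockwise. -/
def Dhat {M : ℕ} (Γ : ContourSystem M) (r : Fin M → ℝ) (α β : Fin (M + 1) → ℝ)
    (n : Fin (M + 1) → ℕ) : ℂ :=
  torusIntegral (zIntegrand Γ α β n) 0 r

/-! ### The simplified integrand for `n_1 ≥ ⋯ ≥ n_m` -/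

/-- `k_i = n_i - n_{i+1}`, where `n_{m+1} = 0`. -/
def gap {M : ℕ} (n : Fin (M + 1) → ℕ) (i : Fin (M + 1)) : ℕ :=
  Fin.lastCases (motive := fun _ => ℕ) (n (Fin.last M))
    (fun j : Fin M => n j.castSucc - n j.succ) i

theorem gap_last {M : ℕ} (n : Fin (M + 1) → ℕ) : n (Fin.last M) = gap n (Fin.last M) := by
  simp [gap]

theorem gap_castSucc {M : ℕ} {n : Fin (M + 1) → ℕ} (hn : Antitone n) (i : Fin M) :
    n i.castSucc = n i.succ + gap n i.castSucc := by
  have h : n i.succ ≤ n i.castSucc := hn i.castSucc_lt_succ.le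
  simp only [gap, Fin.lastCases_castSucc]
  omega

theorem sum_gap {M : ℕ} {n : Fin (M + 1) → ℕ} (hn : Antitone n) :
    ∑ i : Fin (M + 1), gap n i.rev = n 0 := by
  have h : ∑ i : Fin (M + 1), gap n i.rev = ∑ i : Fin (M + 1), gap n i :=
    Equiv.sum_comp Fin.revPerm (gap n)
  have h1 := Fin.sum_univ_succ n
  have h2 := Fin.sum_univ_castSucc n
  have h3 : ∑ i : Fin M, n i.castSucc
      = ∑ i : Fin M, n i.succ + ∑ i : Fin M, gap n i.castSucc := by
    rw [← Finset.sum_add_distrib]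
    exact Finset.sum_congr rfl fun i _ => gap_castSucc hn i
  rw [h, Fin.sum_univ_castSucc, ← gap_last]
  omega

/-- The conjunction `V^{(m)} ⊔ ⋯ ⊔ V^{(1)}`. -/
def revConcat {M : ℕ} {k : Fin (M + 1) → ℕ} (v : Var k → ℂ) :
    Fin (∑ i : Fin (M + 1), k i.rev) → ℂ :=
  fun j => v ⟨(finSigmaFinEquiv.symm j).1.rev, (finSigmaFinEquiv.symm j).2⟩

/-- The integrand
`C(V̂ᵐ ⊔ ⋯ ⊔ V̂¹; U¹) ∏_{i=1}^m C(Uⁱ; Uⁱ⁺¹ ⊔ V̂ⁱ) ∏_{i=1}^m (∏_ℓ F_i(uⁱ_ℓ) / ∏_ℓ f_i(v̂ⁱ_ℓ))`,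
in the variables `w = (u, v̂)`, all `τ_i` being `1`; the factor `i = m` in the middle is
`C(Uᵐ; V̂ᵐ)`. -/
def hatIntegrand {M : ℕ} (α β : Fin (M + 1) → ℝ) {n : Fin (M + 1) → ℕ} (hn : Antitone n)
    (w : Var n ⊕ Var (gap n) → ℂ) : ℂ :=
  let U := vec (fun k : Var n => w (Sum.inl k))
  let V := vec (fun k : Var (gap n) => w (Sum.inr k))
  cauchyDet (revConcat fun k : Var (gap n) => w (Sum.inr k)) (U 0) (sum_gap hn) *
    ((∏ i : Fin M, cauchyDet (U i.castSucc) (Fin.append (U i.succ) (V i.castSucc))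
        (gap_castSucc hn i)) *
      cauchyDet (U (Fin.last M)) (V (Fin.last M)) (gap_last n)) *
    ((∏ k : Var n, F (fun _ => 1) α β k.1 (w (Sum.inl k))) /
      ∏ k : Var (gap n), f (fun _ => 1) α β k.1 (w (Sum.inr k)))

/-- The contours of `(u, v̂)`: `Γ_{i,L}^in` for `u^{(i)}_ℓ` and `Γ_{1,R}` for every `v̂`. -/
def ContourSystem.hatChoice {M : ℕ} (Γ : ContourSystem M) (n : Fin (M + 1) → ℕ) :
    Var n ⊕ Var (gap n) → ℝ → ℂ :=
  Sum.elim (fun k => Γ.left true k.1) (fun _ => Γ.right false 0)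

end AiryD

end

/-! The product of Cauchy determinants is, up to the sign `(-1) ^ card (Var n)`, a single
determinant: `linkMatrix` has the entry 1/(w_x - w_y) where the row label of x equals the column
label of y, and 0 elsewhere. Each variable then owns one row and one column, so the determinant, as
a function of that variable alone, is a sum of terms with at most two simple poles.

For a right variable of level i ≥ 2 the cubic parts of the weight 1/F_i cancel, leaving a Gaussian
exp(-Aw² + Bw) with A = α_i - α_{i-1} > 0. It decays in the sector around the positive axis bounded
by the directions ±π/5, so the contour can be pushed to +∞. A pole on its left contributes nothing,
and a pole on its right contributes a residue.

Part (i). If some v of level ≥ 2 runs over an `in` contour, take one of maximal level. All contours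
it is linked to lie on its left, so the integral vanishes (`confInt_eq_zero`), and only `out`
contours of v survive. Their coefficients cancel the powers of 1 - z⁻¹, because (1 - z⁻¹)(-z/(1 -
z)) = 1. Each z-integral therefore has a simple pole at 0 and no other singularity in the disc. Its
residue is the product of the coefficients of the u-contours at z = 0, namely 1 for `in` and 0 for
`out` (`circleIntegral_levelFactor`).

Part (ii). The right variables are given independent labels row ≤ col and the weight
f_{row-1}/f_col. Pushing one of maximal row label i to infinity crosses exactly the contours of the
right variables y with col y = i - 1. The residue at y identifies the two variables: y inherits the
column label, and the weights telescope to another one of the same kind (`confInt_option`).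
Iteration removes every variable of nonzero row label. The number of choices is a product of falling
factorials, equal to ∏ n_i!/k_i! when n is antitone. All terminal configurations agree up to
relabelling and give the simplified integrand. When n is not antitone no terminal configuration
exists, and the integral is 0 (`confInt_eq_prod_descFactorial_mul`).

The signs relating the single determinant to the two products of Cauchy determinants are the same,
and both come from `sign_eq_of_height`. -/

namespace AiryD

open Filter Topology MeasureTheory

/-! ### Decay of exponentials of cubics along contours -/

/-- The exponential of a real cubic polynomial without constant term. -/
noncomputable def cubicExp (a b d : ℝ) (w : ℂ) : ℂ := Complex.exp (a * w ^ 3 + b * w ^ 2 + d * w)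

theorem differentiable_cubicExp (a b d : ℝ) : Differentiable ℂ (cubicExp a b d) := by
  unfold cubicExp
  fun_prop

theorem cubicExp_ne_zero (a b d : ℝ) (w : ℂ) : cubicExp a b d w ≠ 0 := Complex.exp_ne_zero _

/-- After division by the top power of the modulus, the real part tends to its leading coefficient
evaluated in the limiting direction, which is negative. The summand `‖γ t‖` has lower order; it is
included so that exponential decay in the modulus follows. -/
theorem tendsto_re_cubic {l : Filter ℝ} {γ : ℝ → ℂ} {e : ℂ} {a b d : ℝ}
    (hn : Tendsto (fun t => ‖γ t‖) l atTop)
    (hd : Tendsto (fun t => γ t / (‖γ t‖ : ℂ)) l (𝓝 e))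
    (h : a * (e ^ 3).re < 0 ∨ a = 0 ∧ b * (e ^ 2).re < 0) :
    Tendsto (fun t => (a * γ t ^ 3 + b * γ t ^ 2 + d * γ t : ℂ).re + ‖γ t‖) l atBot := by
  have hi : Tendsto (fun t => ‖γ t‖⁻¹) l (𝓝 0) := tendsto_inv_atTop_zero.comp hn
  have hre : ∀ k : ℕ, Tendsto (fun t => ((γ t / (‖γ t‖ : ℂ)) ^ k).re) l (𝓝 (e ^ k).re) :=
    fun k => (Complex.continuous_re.tendsto _).comp (hd.pow k)
  have hpos : ∀ᶠ t in l, 0 < ‖γ t‖ := hn.eventually_gt_atTop 0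
  have key : ∀ (R : ℝ) (u : ℂ), (a * (R * u) ^ 3 + b * (R * u) ^ 2 + d * (R * u) : ℂ).re
      = R ^ 3 * (a * (u ^ 3).re) + R ^ 2 * (b * (u ^ 2).re) + R * (d * (u ^ 1).re) := by
    intro R u
    have : (a * (R * u) ^ 3 + b * (R * u) ^ 2 + d * (R * u) : ℂ)
        = ((R ^ 3 * a : ℝ) : ℂ) * u ^ 3 + ((R ^ 2 * b : ℝ) : ℂ) * u ^ 2
          + ((R * d : ℝ) : ℂ) * u ^ 1 := by
      push_cast; ring
    rw [this, Complex.add_re, Complex.add_re, Complex.re_ofReal_mul, Complex.re_ofReal_mul,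
      Complex.re_ofReal_mul]
    ring
  have hu : ∀ t, 0 < ‖γ t‖ → γ t = (‖γ t‖ : ℂ) * (γ t / (‖γ t‖ : ℂ)) := by
    intro t ht
    have : (‖γ t‖ : ℂ) ≠ 0 := by exact_mod_cast ht.ne'
    field_simp
  rcases h with h | ⟨rfl, h⟩
  · have h1 : Tendsto (fun t => a * ((γ t / (‖γ t‖ : ℂ)) ^ 3).re
        + ‖γ t‖⁻¹ * (b * ((γ t / (‖γ t‖ : ℂ)) ^ 2).re)
        + ‖γ t‖⁻¹ ^ 2 * (d * ((γ t / (‖γ t‖ : ℂ)) ^ 1).re + 1)) l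
        (𝓝 (a * (e ^ 3).re + 0 * (b * (e ^ 2).re) + 0 ^ 2 * (d * (e ^ 1).re + 1))) :=
      (((hre 3).const_mul a).add (hi.mul ((hre 2).const_mul b))).add
        ((hi.pow 2).mul (((hre 1).const_mul d).add_const 1))
    have h2 : Tendsto (fun t => ‖γ t‖ ^ 3) l atTop :=
      (tendsto_pow_atTop (by norm_num)).comp hn
    refine (h2.atTop_mul_neg (by simpa using h) h1).congr' ?_
    filter_upwards [hpos] with t ht
    conv_rhs => rw [show (a * γ t ^ 3 + b * γ t ^ 2 + d * γ t : ℂ)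
      = a * ((‖γ t‖ : ℂ) * (γ t / (‖γ t‖ : ℂ))) ^ 3
        + b * ((‖γ t‖ : ℂ) * (γ t / (‖γ t‖ : ℂ))) ^ 2
        + d * ((‖γ t‖ : ℂ) * (γ t / (‖γ t‖ : ℂ))) by rw [← hu t ht], key]
    field_simp
    ring
  · have h1 : Tendsto (fun t => b * ((γ t / (‖γ t‖ : ℂ)) ^ 2).re
        + ‖γ t‖⁻¹ * (d * ((γ t / (‖γ t‖ : ℂ)) ^ 1).re + 1)) l
        (𝓝 (b * (e ^ 2).re + 0 * (d * (e ^ 1).re + 1))) :=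
      ((hre 2).const_mul b).add (hi.mul (((hre 1).const_mul d).add_const 1))
    have h2 : Tendsto (fun t => ‖γ t‖ ^ 2) l atTop :=
      (tendsto_pow_atTop (by norm_num)).comp hn
    refine (h2.atTop_mul_neg (by simpa using h) h1).congr' ?_
    filter_upwards [hpos] with t ht
    conv_rhs => rw [show (((0 : ℝ) : ℂ) * γ t ^ 3 + b * γ t ^ 2 + d * γ t : ℂ)
      = ((0 : ℝ) : ℂ) * ((‖γ t‖ : ℂ) * (γ t / (‖γ t‖ : ℂ))) ^ 3
        + b * ((‖γ t‖ : ℂ) * (γ t / (‖γ t‖ : ℂ))) ^ 2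
        + d * ((‖γ t‖ : ℂ) * (γ t / (‖γ t‖ : ℂ))) by rw [← hu t ht], key]
    field_simp
    ring

theorem exp_mul_I_pow_re (x : ℝ) (k : ℕ) :
    (Complex.exp (x * Complex.I) ^ k).re = Real.cos (k * x) := by
  rw [← Complex.exp_nat_mul, ← mul_assoc]
  have : ((k : ℂ) * x) = ((k * x : ℝ) : ℂ) := by push_cast; rfl
  rw [this, Complex.exp_ofReal_mul_I_re]

theorem exp_neg_mul_I_pow_re (x : ℝ) (k : ℕ) :
    (Complex.exp (-x * Complex.I) ^ k).re = Real.cos (k * x) := by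
  have := exp_mul_I_pow_re (-x) k
  rw [mul_neg, Real.cos_neg] at this
  exact_mod_cast this

/-- The continuous exponent, increased by the modulus, tends to -∞ at both ends and so attains a
maximum; the constant is the exponential of that maximum. This is the bound that pairs with the
`length` field of a contour. -/
theorem IsContour.norm_cubicExp_le {θ a b d : ℝ} {γ : ℝ → ℂ} (hγ : IsContour θ γ)
    (h : a * Real.cos (3 * θ) < 0 ∨ a = 0 ∧ b * Real.cos (2 * θ) < 0) :
    ∃ C : ℝ, ∀ t, ‖cubicExp a b d (γ t)‖ ≤ C * Real.exp (-1 * ‖γ t‖) := by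
  have hc := hγ.continuous
  have hcont : Continuous
      (fun t => (a * γ t ^ 3 + b * γ t ^ 2 + d * γ t : ℂ).re + ‖γ t‖) := by fun_prop
  have hlim : Tendsto (fun t => (a * γ t ^ 3 + b * γ t ^ 2 + d * γ t : ℂ).re + ‖γ t‖)
      (cocompact ℝ) atBot := by
    rw [cocompact_eq_atBot_atTop]
    refine Tendsto.sup ?_ ?_
    · refine tendsto_re_cubic hγ.norm_atBot hγ.dir_atBot ?_
      simpa only [exp_neg_mul_I_pow_re, Nat.cast_ofNat] using h
    · refine tendsto_re_cubic hγ.norm_atTop hγ.dir_atTop ?_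
      simpa only [exp_mul_I_pow_re, Nat.cast_ofNat] using h
  obtain ⟨t₀, ht₀⟩ := hcont.exists_forall_ge hlim
  refine ⟨Real.exp ((a * γ t₀ ^ 3 + b * γ t₀ ^ 2 + d * γ t₀ : ℂ).re + ‖γ t₀‖), fun t => ?_⟩
  rw [cubicExp, Complex.norm_exp, ← Real.exp_add, Real.exp_le_exp]
  linarith [ht₀ t]

theorem IsContour.integrable_mul_deriv {θ : ℝ} {γ : ℝ → ℂ} (hγ : IsContour θ γ) {φ : ℂ → ℂ}
    (hφ : Continuous φ) (h : ∃ C : ℝ, ∀ t, ‖φ (γ t)‖ ≤ C * Real.exp (-1 * ‖γ t‖)) :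
    Integrable (fun t => φ (γ t) * deriv γ t) := by
  obtain ⟨C, hC⟩ := h
  refine ((hγ.length 1 one_pos).const_mul C).mono'
    ((hφ.comp hγ.continuous).aestronglyMeasurable.mul
      (measurable_deriv γ).aestronglyMeasurable) (Eventually.of_forall fun t => ?_)
  rw [norm_mul]
  calc ‖φ (γ t)‖ * ‖deriv γ t‖ ≤ C * Real.exp (-1 * ‖γ t‖) * ‖deriv γ t‖ := by
        gcongr; exact hC t
    _ = _ := by ring

/-! ### Cauchy transforms, analytic continuation, truncation points -/

theorem IsContour.isClosed_range {θ : ℝ} {γ : ℝ → ℂ} (hγ : IsContour θ γ) :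
    IsClosed (Set.range γ) := by
  have h : Tendsto γ (cocompact ℝ) (cocompact ℂ) := by
    rw [← Metric.cobounded_eq_cocompact (α := ℂ), ← comap_norm_atTop, tendsto_comap_iff,
      cocompact_eq_atBot_atTop]
    exact hγ.norm_atBot.sup hγ.norm_atTop
  exact (isProperMap_iff_tendsto_cocompact.2 ⟨hγ.continuous, h⟩).isClosedMap.isClosed_range

/-- Differentiation under the integral sign: on half of a ball missing the contour the denominators
stay bounded away from 0. Holomorphy is what allows transforms, once computed at convenient points,
to be continued along the paths in `OnLeft` and `OnRight`. -/
theorem differentiableOn_cauchyTransform {γ ψ : ℝ → ℂ} (hγ : Continuous γ)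
    (hcl : IsClosed (Set.range γ)) (hψ : Integrable ψ) :
    DifferentiableOn ℂ (fun p => ∫ t, ψ t / (γ t - p)) (Set.range γ)ᶜ := by
  intro p₀ hp₀
  obtain ⟨ε, hε, hball⟩ := Metric.isOpen_iff.1 hcl.isOpen_compl p₀ hp₀
  have hne : ∀ p ∈ Metric.ball p₀ (ε / 2), ∀ t, ε / 2 ≤ ‖γ t - p‖ := by
    intro p hp t
    have h1 : ε ≤ dist (γ t) p₀ := by
      by_contra hlt
      exact hball (Metric.mem_ball.2 (not_le.1 hlt)) ⟨t, rfl⟩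
    have h2 := dist_triangle (γ t) p p₀
    rw [Metric.mem_ball] at hp
    rw [← dist_eq_norm]
    linarith
  have hne0 : ∀ p ∈ Metric.ball p₀ (ε / 2), ∀ t, γ t - p ≠ 0 := fun p hp t h => by
    have := hne p hp t
    rw [h, norm_zero] at this
    linarith
  have hmeas : ∀ p ∈ Metric.ball p₀ (ε / 2), ∀ k : ℕ,
      AEStronglyMeasurable (fun t => ψ t / (γ t - p) ^ k) := by
    intro p hp k
    refine hψ.aestronglyMeasurable.div₀ ?_ |>.congr (by rfl)
    exact (by fun_prop : Continuous fun t => (γ t - p) ^ k).aestronglyMeasurable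
  have hp0 : p₀ ∈ Metric.ball p₀ (ε / 2) := Metric.mem_ball_self (by linarith)
  refine (hasDerivAt_integral_of_dominated_loc_of_deriv_le (μ := volume)
    (F := fun p t => ψ t / (γ t - p)) (F' := fun p t => ψ t / (γ t - p) ^ 2)
    (bound := fun t => ‖ψ t‖ * ((ε / 2) ^ 2)⁻¹)
    (Metric.ball_mem_nhds p₀ (half_pos hε)) ?_ ?_ (hmeas p₀ hp0 2) ?_ (hψ.norm.mul_const _)
    ?_).2.differentiableAt.differentiableWithinAt
  · filter_upwards [Metric.ball_mem_nhds p₀ (half_pos hε)] with p hp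
    simpa using hmeas p hp 1
  · refine (hψ.norm.mul_const (ε / 2)⁻¹).mono' (by simpa using hmeas p₀ hp0 1)
      (Eventually.of_forall fun t => ?_)
    rw [norm_div, div_eq_mul_inv]
    gcongr
    exact hne p₀ hp0 t
  · refine Eventually.of_forall fun t p hp => ?_
    rw [norm_div, div_eq_mul_inv, norm_pow]
    gcongr
    exact hne p hp t
  · refine Eventually.of_forall fun t p hp => ?_
    have h1 : HasDerivAt (fun p => γ t - p) (-1) p := by
      simpa using (hasDerivAt_id p).const_sub (γ t)
    refine ((hasDerivAt_const p (ψ t)).div h1 (hne0 p hp t)).congr_deriv ?_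
    ring

/-- Analytic continuation along a path. -/
theorem eq_zero_of_joinedIn {U : Set ℂ} (hU : IsOpen U) {G : ℂ → ℂ} (hG : DifferentiableOn ℂ G U)
    {p q : ℂ} (hpq : JoinedIn U p q) (hq : ∃ᶠ z in 𝓝[≠] q, G z = 0) : G p = 0 := by
  obtain ⟨c, hc⟩ := hpq
  have hsub : Set.range c ⊆ U := by rintro _ ⟨t, rfl⟩; exact hc t
  have han : AnalyticOnNhd ℂ G (Set.range c) := (hG.analyticOnNhd hU).mono hsub
  exact han.eqOn_zero_of_preconnected_of_frequently_eq_zero (isPreconnected_range c.continuous)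
    ⟨1, c.target⟩ hq ⟨0, c.source⟩

/-- The intermediate value theorem provides the points. They escape to infinity because `g` is
bounded on every compact interval. -/
theorem exists_seq_eq_natCast {g : ℝ → ℝ} (hg : Continuous g) (hlim : Tendsto g atTop atTop) :
    ∃ T : ℕ → ℝ, Tendsto T atTop atTop ∧ ∀ᶠ n : ℕ in atTop, g (T n) = n := by
  have hex : ∀ n : ℕ, ∃ t : ℝ, 0 ≤ t ∧ (g 0 ≤ n → g t = n) := by
    intro n
    by_cases h : g 0 ≤ n
    · obtain ⟨b, hb0, hb⟩ := ((eventually_ge_atTop (0 : ℝ)).and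
        (hlim.eventually_ge_atTop (n : ℝ))).exists
      obtain ⟨t, ht, hgt⟩ := intermediate_value_Icc hb0 hg.continuousOn ⟨h, hb⟩
      exact ⟨t, ht.1, fun _ => hgt⟩
    -- A junk value, used only for the finitely many `n` below `g 0`.
    · exact ⟨0, le_rfl, fun h' => absurd h' h⟩
  choose T hT0 hT using hex
  have hev : ∀ᶠ n : ℕ in atTop, g (T n) = n := by
    filter_upwards [(tendsto_natCast_atTop_atTop (R := ℝ)).eventually_ge_atTop (g 0)] with n hn
    exact hT n hn
  refine ⟨T, tendsto_atTop.2 fun B => ?_, hev⟩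
  obtain ⟨C, hC⟩ := (isCompact_Icc (a := 0) (b := B)).bddAbove_image hg.continuousOn
  filter_upwards [hev, (tendsto_natCast_atTop_atTop (R := ℝ)).eventually_gt_atTop C] with n h1 h2
  by_contra hlt
  have := hC ⟨T n, ⟨hT0 n, (not_le.1 hlt).le⟩, rfl⟩
  rw [h1] at this
  linarith

/-- Truncating both ends at the same modulus puts both endpoints of a right contour into the same
convex set `farRegion n`, where a primitive can be compared along a segment. -/
theorem IsContour.exists_balanced {θ : ℝ} {γ : ℝ → ℂ} (hγ : IsContour θ γ) :
    ∃ T S : ℕ → ℝ, Tendsto T atTop atTop ∧ Tendsto S atTop atBot ∧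
      ∀ᶠ n : ℕ in atTop, ‖γ (T n)‖ = n ∧ ‖γ (S n)‖ = n := by
  obtain ⟨T, hT, hT'⟩ := exists_seq_eq_natCast hγ.continuous.norm hγ.norm_atTop
  obtain ⟨S, hS, hS'⟩ := exists_seq_eq_natCast
    (hγ.continuous.norm.comp continuous_neg) (hγ.norm_atBot.comp tendsto_neg_atTop_atBot)
  exact ⟨T, fun n => -S n, hT, tendsto_neg_atTop_atBot.comp hS, hT'.and hS'⟩

/-! ### The sector around the ends of a right contour -/

theorem four_fifths_lt_cos : (4 / 5 : ℝ) < Real.cos (Real.pi / 5) := by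
  rw [Real.cos_pi_div_five]
  have : (2.2 : ℝ) < √5 := Real.lt_sqrt_of_sq_lt (by norm_num)
  linarith

theorem sin_pi_div_five_bounds :
    0 < Real.sin (Real.pi / 5) ∧ Real.sin (Real.pi / 5) < 3 / 5 := by
  have h0 : 0 < Real.sin (Real.pi / 5) :=
    Real.sin_pos_of_pos_of_lt_pi (by positivity) (by linarith [Real.pi_pos])
  refine ⟨h0, ?_⟩
  have := Real.sin_sq_add_cos_sq (Real.pi / 5)
  nlinarith [four_fifths_lt_cos]

/-- The part of the sector `|arg w| ≤ arcsin (3/5)` near the circle of radius `x`. -/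
def farRegion (x : ℝ) : Set ℂ := {w | 4 / 5 * x ≤ w.re ∧ |w.im| ≤ 3 / 5 * x ∧ ‖w‖ ≤ x}

theorem convex_farRegion (x : ℝ) : Convex ℝ (farRegion x) := by
  have h1 : Convex ℝ {w : ℂ | 4 / 5 * x ≤ w.re} := convex_halfSpace_re_ge _
  have h2 : Convex ℝ {w : ℂ | w.im ≤ 3 / 5 * x} := convex_halfSpace_im_le _
  have h3 : Convex ℝ {w : ℂ | -(3 / 5 * x) ≤ w.im} := convex_halfSpace_im_ge _
  have h4 : Convex ℝ (Metric.closedBall (0 : ℂ) x) := convex_closedBall _ _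
  convert h1.inter ((h3.inter h2).inter h4) using 1
  ext w
  simp [farRegion, abs_le]

/-- In this region Re w² ≥ (16/25 - 9/25) x² = (7/25) x². -/
theorem norm_cubicExp_le_of_mem_farRegion {A B x : ℝ} (hA : 0 < A) (hx : 0 ≤ x) {w : ℂ}
    (hw : w ∈ farRegion x) :
    ‖cubicExp 0 (-A) B w‖ ≤ Real.exp (-(7 / 25 * A) * x ^ 2 + |B| * x) := by
  obtain ⟨h1, h2, h3⟩ := hw
  rw [cubicExp, Complex.norm_exp, Real.exp_le_exp]
  have hre : ((0 : ℝ) * w ^ 3 + (-A : ℝ) * w ^ 2 + B * w : ℂ).re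
      = -A * (w.re ^ 2 - w.im ^ 2) + B * w.re := by
    rw [Complex.add_re, Complex.add_re, Complex.re_ofReal_mul, Complex.re_ofReal_mul,
      Complex.re_ofReal_mul, pow_two w, Complex.mul_re]
    ring
  rw [hre]
  have h4 : B * w.re ≤ |B| * x := by
    calc B * w.re ≤ |B * w.re| := le_abs_self _
      _ = |B| * |w.re| := abs_mul _ _
      _ ≤ |B| * x := by gcongr; exact (Complex.abs_re_le_norm w).trans h3
  have h5 : (4 / 5 * x) ^ 2 ≤ w.re ^ 2 := by gcongr
  have h6 : w.im ^ 2 ≤ (3 / 5 * x) ^ 2 := by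
    rw [← sq_abs w.im]; gcongr
  nlinarith

/-- This replaces closing the contour by an arc: by the mean value inequality on a convex set, the
difference of the primitive is at most a Gaussian bound times the distance 2n of the endpoints. -/
theorem tendsto_sub_of_farRegion {A B : ℝ} (hA : 0 < A) {p : ℂ} {H : ℂ → ℂ}
    (hH : ∀ w, p.re < w.re → HasDerivAt H (cubicExp 0 (-A) B w / (w - p)) w)
    {y z : ℕ → ℂ} (hy : ∀ᶠ n : ℕ in atTop, y n ∈ farRegion n)
    (hz : ∀ᶠ n : ℕ in atTop, z n ∈ farRegion n) :
    Tendsto (fun n => H (y n) - H (z n)) atTop (𝓝 0) := by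
  have hlim : Tendsto (fun x : ℝ => Real.exp (-(7 / 25 * A) * x ^ 2 + |B| * x) * (2 * x)) atTop
      (𝓝 0) := by
    -- The extra 2 beside |B| absorbs the length factor, since 2x ≤ exp(2x).
    have h1 : Tendsto (fun x : ℝ => x * ((7 / 25 * A) * x + -(|B| + 2))) atTop atTop := by
      refine tendsto_id.atTop_mul_atTop₀ ?_
      exact tendsto_atTop_add_const_right _ _ (tendsto_id.const_mul_atTop (by positivity))
    have h2 := Real.tendsto_exp_neg_atTop_nhds_zero.comp h1
    refine tendsto_of_tendsto_of_tendsto_of_le_of_le' tendsto_const_nhds h2 ?_ ?_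
    · filter_upwards [eventually_ge_atTop (0 : ℝ)] with x hx
      positivity
    · filter_upwards with x
      have h3 : 2 * x ≤ Real.exp (2 * x) := by linarith [Real.add_one_le_exp (2 * x)]
      calc _ ≤ Real.exp (-(7 / 25 * A) * x ^ 2 + |B| * x) * Real.exp (2 * x) := by gcongr
        _ = _ := by
          rw [← Real.exp_add]
          simp only [Function.comp]
          congr 1
          ring
  have hlim' := hlim.comp (tendsto_natCast_atTop_atTop (R := ℝ))
  refine squeeze_zero_norm' ?_ hlim'
  -- With this lower bound on n, 4n/5 ≥ ‖p‖ + 1, so the whole region lies to the right of p at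
  -- distance at least 1.
  filter_upwards [hy, hz, (tendsto_natCast_atTop_atTop (R := ℝ)).eventually_ge_atTop
    (5 / 4 * (‖p‖ + 1))] with n h1 h2 hn
  have hfar : ∀ w ∈ farRegion n, 1 ≤ ‖w - p‖ ∧ p.re < w.re := by
    intro w hw
    have h3 : p.re + 1 ≤ w.re := by linarith [hw.1, Complex.re_le_norm p]
    refine ⟨?_, by linarith⟩
    have := Complex.re_le_norm (w - p)
    rw [Complex.sub_re] at this
    linarith
  have hn0 : (0 : ℝ) ≤ n := n.cast_nonneg
  have := (convex_farRegion n).norm_image_sub_le_of_norm_hasDerivWithin_le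
    (fun w hw => (hH w (hfar w hw).2).hasDerivWithinAt)
    (C := Real.exp (-(7 / 25 * A) * (n : ℝ) ^ 2 + |B| * n)) ?_ h2 h1
  · refine this.trans ?_
    simp only [Function.comp]
    gcongr
    calc ‖y n - z n‖ ≤ ‖y n‖ + ‖z n‖ := norm_sub_le _ _
      _ ≤ n + n := add_le_add h1.2.2 h2.2.2
      _ = 2 * n := by ring
  · intro w hw
    rw [norm_div]
    exact (div_le_self (norm_nonneg _) (hfar w hw).1).trans
      (norm_cubicExp_le_of_mem_farRegion hA hn0 hw)

theorem IsContour.eventually_atTop_mem {γ : ℝ → ℂ} (hγ : IsContour (Real.pi / 5) γ) :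
    ∀ᶠ t in atTop, γ t ∈ farRegion ‖γ t‖ ∧ 0 < (γ t).im := by
  have h1 := (Complex.continuous_re.tendsto _).comp hγ.dir_atTop
  have h2 := (Complex.continuous_im.tendsto _).comp hγ.dir_atTop
  rw [Complex.exp_ofReal_mul_I_re] at h1
  rw [Complex.exp_ofReal_mul_I_im] at h2
  filter_upwards [hγ.norm_atTop.eventually_gt_atTop 0, h1.eventually_const_lt four_fifths_lt_cos,
    h2.eventually_const_lt sin_pi_div_five_bounds.1,
    h2.eventually_lt_const sin_pi_div_five_bounds.2] with t h0 h3 h4 h5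
  simp only [Function.comp, Complex.div_ofReal_re, Complex.div_ofReal_im] at h3 h4 h5
  rw [lt_div_iff₀ h0] at h3
  rw [div_lt_iff₀ h0] at h5
  have him : 0 < (γ t).im := by
    by_contra hneg
    exact absurd h4 (not_lt.2 (div_nonpos_of_nonpos_of_nonneg (not_lt.1 hneg) h0.le))
  exact ⟨⟨h3.le, by rw [abs_of_pos him]; exact h5.le, le_rfl⟩, him⟩

theorem IsContour.eventually_atBot_mem {γ : ℝ → ℂ} (hγ : IsContour (Real.pi / 5) γ) :
    ∀ᶠ t in atBot, γ t ∈ farRegion ‖γ t‖ ∧ (γ t).im < 0 := by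
  have h1 := (Complex.continuous_re.tendsto _).comp hγ.dir_atBot
  have h2 := (Complex.continuous_im.tendsto _).comp hγ.dir_atBot
  have he : -((Real.pi / 5 : ℝ) : ℂ) = ((-(Real.pi / 5) : ℝ) : ℂ) := by push_cast; ring
  rw [he] at h1 h2
  rw [Complex.exp_ofReal_mul_I_re, Real.cos_neg] at h1
  rw [Complex.exp_ofReal_mul_I_im, Real.sin_neg] at h2
  filter_upwards [hγ.norm_atBot.eventually_gt_atTop 0, h1.eventually_const_lt four_fifths_lt_cos,
    h2.eventually_const_lt (neg_lt_neg sin_pi_div_five_bounds.2),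
    h2.eventually_lt_const (neg_neg_of_pos sin_pi_div_five_bounds.1)] with t h0 h3 h4 h5
  simp only [Function.comp, Complex.div_ofReal_re, Complex.div_ofReal_im] at h3 h4 h5
  rw [lt_div_iff₀ h0] at h3 h4
  have him : (γ t).im < 0 := by
    by_contra hneg
    exact absurd h5 (not_lt.2 (div_nonneg (not_lt.1 hneg) h0.le))
  exact ⟨⟨h3.le, by rw [abs_of_neg him]; linarith, le_rfl⟩, him⟩

/-! ### Primitives along a contour and the sides of a contour -/

theorem IsContour.integral_eq_sub {θ : ℝ} {γ : ℝ → ℂ} (hγ : IsContour θ γ) {h H : ℂ → ℂ}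
    (hH : ∀ t, HasDerivAt H (h (γ t)) (γ t)) (hint : Integrable fun t => h (γ t) * deriv γ t)
    (a b : ℝ) : ∫ t in a..b, h (γ t) * deriv γ t = H (γ b) - H (γ a) := by
  obtain ⟨s, hs⟩ := hγ.piecewise
  refine integral_eq_of_hasDerivAt_off_countable (fun t => H (γ t)) _ s.countable_toSet ?_ ?_
    hint.intervalIntegrable
  · exact (continuous_iff_continuousAt.2 fun t =>
      (hH t).continuousAt.comp hγ.continuous.continuousAt).continuousOn
  · intro t ht
    exact (hH t).comp t ((hs t ht.2).differentiableAt (by norm_num)).hasDerivAt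

/-- The logarithmic part of a primitive of `φ(w) / (w - p)`, completed by a primitive of an
entire function. -/
theorem exists_log_primitive {φ : ℂ → ℂ} (hφ : Differentiable ℂ φ) (p : ℂ) :
    ∃ K : ℂ → ℂ,
      (∀ w, w - p ∈ Complex.slitPlane →
        HasDerivAt (fun w => φ p * Complex.log (w - p) + K w) (φ w / (w - p)) w) ∧
      ∀ w, p - w ∈ Complex.slitPlane →
        HasDerivAt (fun w => φ p * Complex.log (p - w) + K w) (φ w / (w - p)) w := by
  -- Splitting φ(w)/(w - p) into φ(p)/(w - p) and the entire function (φ(w) - φ(p))/(w - p) confines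
  -- the multivaluedness to one logarithm, whose branch can be chosen.
  have hd : Differentiable ℂ (dslope φ p) := by
    rw [← differentiableOn_univ] at hφ ⊢
    exact (Complex.differentiableOn_dslope univ_mem).2 hφ
  obtain ⟨K, hK⟩ := hd.isExactOn_univ
  have hK' : ∀ w, w - p ≠ 0 → HasDerivAt K ((φ w - φ p) / (w - p)) w := by
    intro w hw
    have := hK w (Set.mem_univ w)
    rwa [dslope_of_ne _ (sub_ne_zero.1 hw), slope_def_field] at this
  refine ⟨K, fun w hw => ?_, fun w hw => ?_⟩
  · have h0 : w - p ≠ 0 := Complex.slitPlane_ne_zero hw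
    have h1 := (((hasDerivAt_id w).sub_const p).clog hw).const_mul (φ p)
    refine (h1.add (hK' w h0)).congr_deriv ?_
    simp only [id]
    field_simp
    ring
  · have h0 : w - p ≠ 0 := by
      rw [← neg_ne_zero, neg_sub]; exact Complex.slitPlane_ne_zero hw
    have h0' : p - w ≠ 0 := Complex.slitPlane_ne_zero hw
    have h1 := (((hasDerivAt_id w).const_sub p).clog hw).const_mul (φ p)
    refine (h1.add (hK' w h0)).congr_deriv ?_
    simp only [id]
    rw [show p - w = -(w - p) by ring]
    field_simp
    ring

theorem exists_le_norm_sub_of_notMem {γ : ℝ → ℂ} (hcl : IsClosed (Set.range γ)) {p : ℂ}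
    (hp : p ∉ Set.range γ) : ∃ ε > 0, ∀ t, ε ≤ ‖γ t - p‖ := by
  obtain ⟨ε, hε, hball⟩ := Metric.isOpen_iff.1 hcl.isOpen_compl p hp
  refine ⟨ε, hε, fun t => ?_⟩
  by_contra hlt
  exact hball (Metric.mem_ball.2 (by rw [dist_eq_norm]; exact not_le.1 hlt)) ⟨t, rfl⟩

theorem integrable_div_sub {γ ψ : ℝ → ℂ} (hγ : Continuous γ) (hψ : Integrable ψ) {p : ℂ}
    (hp : ∃ ε > 0, ∀ t, ε ≤ ‖γ t - p‖) : Integrable (fun t => ψ t / (γ t - p)) := by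
  obtain ⟨ε, hε, hle⟩ := hp
  refine (hψ.norm.mul_const ε⁻¹).mono' (hψ.aestronglyMeasurable.div₀
    (by fun_prop : Continuous fun t => γ t - p).aestronglyMeasurable)
    (Eventually.of_forall fun t => ?_)
  rw [norm_div, div_eq_mul_inv]
  gcongr
  exact hle t

theorem OnLeft.notMem {γ : ℝ → ℂ} {p : ℂ} (h : OnLeft γ p) : p ∉ Set.range γ :=
  (Eventually.exists h).choose_spec.source_mem

theorem OnRight.notMem {γ : ℝ → ℂ} {p : ℂ} (h : OnRight γ p) : p ∉ Set.range γ :=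
  (Eventually.exists h).choose_spec.source_mem

theorem onLeft_of_re_neg {γ : ℝ → ℂ} (hre : ∀ t, 0 < (γ t).re) {p : ℂ} (hp : p.re < 0) :
    OnLeft γ p := by
  filter_upwards [eventually_lt_atBot (0 : ℝ)] with x hx
  have h1 : JoinedIn {w : ℂ | w.re < 0} p x :=
    ((convex_halfSpace_re_lt 0).isPathConnected ⟨p, hp⟩).joinedIn p hp x (by simpa using hx)
  refine h1.mono ?_
  rintro w hw ⟨t, rfl⟩
  exact absurd (hre t) (not_lt.2 (le_of_lt hw))

theorem OnLeft.eventually_nhds {γ : ℝ → ℂ} (hcl : IsClosed (Set.range γ)) {p : ℂ}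
    (h : OnLeft γ p) : ∀ᶠ q in 𝓝 p, OnLeft γ q := by
  obtain ⟨ε, hε, hball⟩ := Metric.isOpen_iff.1 hcl.isOpen_compl p h.notMem
  filter_upwards [Metric.ball_mem_nhds p hε] with q hq
  have h1 : JoinedIn (Set.range γ)ᶜ q p :=
    (((convex_ball p ε).isPathConnected ⟨q, hq⟩).joinedIn q hq p
      (Metric.mem_ball_self hε)).mono hball
  exact Eventually.mono h fun x hx => h1.trans hx

/-! ### Cauchy transforms of Gaussians over right contours -/

section Right

variable {γ : ℝ → ℂ} (hγ : IsContour (Real.pi / 5) γ) (hre : ∀ t, 0 < (γ t).re)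
  {A B : ℝ} (hA : 0 < A)

include hγ hA in
theorem IsContour.integrable_gaussian :
    Integrable (fun t => cubicExp 0 (-A) B (γ t) * deriv γ t) := by
  refine hγ.integrable_mul_deriv (differentiable_cubicExp _ _ _).continuous
    (hγ.norm_cubicExp_le (Or.inr ⟨rfl, ?_⟩))
  have : 0 < Real.cos (2 * (Real.pi / 5)) :=
    Real.cos_pos_of_mem_Ioo ⟨by linarith [Real.pi_pos], by linarith [Real.pi_pos]⟩
  nlinarith

include hγ in
theorem IsContour.integral_div_sub_eq_of_tendsto {φ : ℂ → ℂ} {p L : ℂ}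
    (hint : Integrable fun t => φ (γ t) * deriv γ t) (hp : p ∉ Set.range γ)
    {H : ℂ → ℂ} (hH : ∀ t, HasDerivAt H (φ (γ t) / (γ t - p)) (γ t)) {T S : ℕ → ℝ}
    (hT : Tendsto T atTop atTop) (hS : Tendsto S atTop atBot)
    (hL : Tendsto (fun n => H (γ (T n)) - H (γ (S n))) atTop (𝓝 L)) :
    ∫ t, φ (γ t) * deriv γ t / (γ t - p) = L := by
  have hint' := integrable_div_sub hγ.continuous hint
    (exists_le_norm_sub_of_notMem hγ.isClosed_range hp)
  refine tendsto_nhds_unique (intervalIntegral_tendsto_integral hint' hS hT) ?_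
  have hint'' : Integrable fun t => (fun w => φ w / (w - p)) (γ t) * deriv γ t := by
    refine hint'.congr (Eventually.of_forall fun t => ?_)
    ring
  refine hL.congr fun n => ?_
  rw [← hγ.integral_eq_sub (h := fun w => φ w / (w - p)) hH hint'']
  refine intervalIntegral.integral_congr fun t _ => ?_
  ring

include hγ in
theorem IsContour.exists_balanced_far :
    ∃ T S : ℕ → ℝ, Tendsto T atTop atTop ∧ Tendsto S atTop atBot ∧
      (∀ᶠ n : ℕ in atTop, γ (T n) ∈ farRegion n ∧ 0 < (γ (T n)).im) ∧
      ∀ᶠ n : ℕ in atTop, γ (S n) ∈ farRegion n ∧ (γ (S n)).im < 0 := by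
  obtain ⟨T, S, hT, hS, hn⟩ := hγ.exists_balanced
  refine ⟨T, S, hT, hS, ?_, ?_⟩
  · filter_upwards [hn, hT.eventually hγ.eventually_atTop_mem] with n h1 h2
    rwa [h1.1] at h2
  · filter_upwards [hn, hS.eventually hγ.eventually_atBot_mem] with n h1 h2
    rwa [h1.2] at h2

include hγ hre hA in
-- The contour stays strictly to the right of p, so the principal branch of log(w - p) gives one
-- primitive valid along all of it and in the far region, where its increments die out.
theorem integral_gaussian_div_sub_of_re_nonpos {p : ℂ} (hp : p.re ≤ 0) :
    ∫ t, cubicExp 0 (-A) B (γ t) * deriv γ t / (γ t - p) = 0 := by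
  obtain ⟨K, hK, -⟩ := exists_log_primitive (differentiable_cubicExp 0 (-A) B) p
  obtain ⟨T, S, hT, hS, hT', hS'⟩ := hγ.exists_balanced_far
  have hslit : ∀ w : ℂ, p.re < w.re → w - p ∈ Complex.slitPlane := fun w hw => by
    rw [Complex.mem_slitPlane_iff]
    left
    simpa using hw
  refine hγ.integral_div_sub_eq_of_tendsto (hγ.integrable_gaussian hA) ?_
    (fun t => hK _ (hslit _ (hp.trans_lt (hre t)))) hT hS
    (tendsto_sub_of_farRegion hA (fun w hw => hK w (hslit w hw)) (hT'.mono fun _ h => h.1)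
      (hS'.mono fun _ h => h.1))
  rintro ⟨t, rfl⟩
  exact absurd (hre t) (not_lt.2 hp)

include hγ hre hA in
-- The path to a negative real number continues the vanishing from the left half plane up to p.
theorem integral_gaussian_div_sub_of_onLeft {p : ℂ} (hp : OnLeft γ p) :
    ∫ t, cubicExp 0 (-A) B (γ t) * deriv γ t / (γ t - p) = 0 := by
  obtain ⟨x, hx, hpx⟩ := ((eventually_lt_atBot (0 : ℝ)).and hp).exists
  refine eq_zero_of_joinedIn hγ.isClosed_range.isOpen_compl
    (differentiableOn_cauchyTransform hγ.continuous hγ.isClosed_range (hγ.integrable_gaussian hA))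
    hpx (Eventually.frequently ?_)
  have : {w : ℂ | w.re < 0} ∈ 𝓝 (x : ℂ) :=
    (isOpen_lt Complex.continuous_re continuous_const).mem_nhds (by simpa using hx)
  filter_upwards [mem_nhdsWithin_of_mem_nhds this] with w hw
  exact integral_gaussian_div_sub_of_re_nonpos hγ hre hA (le_of_lt hw)

theorem div_sub_mul_sub (z a p q : ℂ) (hp : a - p ≠ 0) (hq : a - q ≠ 0) (hpq : p ≠ q) :
    z / (a - p) / (a - q) = (z / (a - p) - z / (a - q)) / (p - q) := by
  have : p - q ≠ 0 := sub_ne_zero.2 hpq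
  field_simp
  ring

include hγ hA in
theorem integral_gaussian_div_sub_div_sub_of_ne {p q : ℂ} (hp : p ∉ Set.range γ)
    (hq : q ∉ Set.range γ) (hpq : p ≠ q) :
    ∫ t, cubicExp 0 (-A) B (γ t) * deriv γ t / (γ t - p) / (γ t - q)
      = ((∫ t, cubicExp 0 (-A) B (γ t) * deriv γ t / (γ t - p))
        - ∫ t, cubicExp 0 (-A) B (γ t) * deriv γ t / (γ t - q)) / (p - q) := by
  rw [← integral_sub, ← integral_div]
  · refine integral_congr_ae (Eventually.of_forall fun t => div_sub_mul_sub _ _ _ _ ?_ ?_ hpq)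
    · exact fun h => hp ⟨t, sub_eq_zero.1 h⟩
    · exact fun h => hq ⟨t, sub_eq_zero.1 h⟩
  · exact integrable_div_sub hγ.continuous (hγ.integrable_gaussian hA)
      (exists_le_norm_sub_of_notMem hγ.isClosed_range hp)
  · exact integrable_div_sub hγ.continuous (hγ.integrable_gaussian hA)
      (exists_le_norm_sub_of_notMem hγ.isClosed_range hq)

include hγ hre hA in
-- Partial fractions handle distinct points. Coinciding points do occur, and are reached as a limit,
-- since being on the left is an open condition.
theorem integral_gaussian_div_sub_div_sub_of_onLeft {p q : ℂ} (hp : OnLeft γ p)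
    (hq : OnLeft γ q) :
    ∫ t, cubicExp 0 (-A) B (γ t) * deriv γ t / (γ t - p) / (γ t - q) = 0 := by
  have hne : ∀ q', OnLeft γ q' → p ≠ q' →
      ∫ t, cubicExp 0 (-A) B (γ t) * deriv γ t / (γ t - p) / (γ t - q') = 0 := by
    intro q' hq' h
    rw [integral_gaussian_div_sub_div_sub_of_ne hγ hA hp.notMem hq'.notMem h,
      integral_gaussian_div_sub_of_onLeft hγ hre hA hp,
      integral_gaussian_div_sub_of_onLeft hγ hre hA hq', sub_zero, zero_div]
  by_cases h : p = q
  · subst h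
    have hd := differentiableOn_cauchyTransform hγ.continuous hγ.isClosed_range
      (integrable_div_sub hγ.continuous (hγ.integrable_gaussian (B := B) hA)
        (exists_le_norm_sub_of_notMem hγ.isClosed_range hp.notMem))
    have hc := (hd.continuousOn.continuousAt
      (hγ.isClosed_range.isOpen_compl.mem_nhds hp.notMem)).tendsto.mono_left
      (nhdsWithin_le_nhds (s := {p}ᶜ))
    refine tendsto_nhds_unique hc (tendsto_const_nhds.congr' ?_)
    filter_upwards [mem_nhdsWithin_of_mem_nhds (hp.eventually_nhds hγ.isClosed_range),
      self_mem_nhdsWithin] with q' h1 h2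
    exact (hne q' h1 (Ne.symm h2)).symm
  · exact hne q hq h

include hγ in
-- The ray from a large x to +∞ misses the contour: both tails have nonzero imaginary part, and the
-- compact middle has bounded real part.
theorem IsContour.eventually_avoids :
    ∀ᶠ x : ℝ in atTop, ∀ t, (x : ℂ) - γ t ∈ Complex.slitPlane := by
  obtain ⟨a, ha⟩ := eventually_atBot.1 hγ.eventually_atBot_mem
  obtain ⟨b, hb⟩ := eventually_atTop.1 hγ.eventually_atTop_mem
  obtain ⟨C, hC⟩ := (isCompact_Icc (a := a) (b := b)).bddAbove_image
    (Complex.continuous_re.comp hγ.continuous).continuousOn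
  filter_upwards [eventually_gt_atTop C] with x hx t
  rw [Complex.mem_slitPlane_iff]
  by_cases h1 : t ≤ a
  · right
    simpa using (ha t h1).2.ne
  by_cases h2 : b ≤ t
  · right
    simpa using (hb t h2).2.ne'
  · left
    have : (γ t).re ≤ C := hC ⟨t, ⟨(not_le.1 h1).le, (not_le.1 h2).le⟩, rfl⟩
    simp only [Complex.sub_re, Complex.ofReal_re]
    linarith

theorem log_real_sub_of_im_pos {x : ℝ} {w : ℂ} (hw : 0 < w.im) :
    Complex.log (x - w) = Complex.log (w - x) - Real.pi * Complex.I := by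
  have h1 : (x : ℂ) - w = -(w - x) := by ring
  have h2 : 0 < (w - x).im := by simpa using hw
  rw [h1, Complex.log, Complex.log, norm_neg, Complex.arg_neg_eq_arg_sub_pi_of_im_pos h2]
  push_cast
  ring

theorem log_real_sub_of_im_neg {x : ℝ} {w : ℂ} (hw : w.im < 0) :
    Complex.log (x - w) = Complex.log (w - x) + Real.pi * Complex.I := by
  have h1 : (x : ℂ) - w = -(w - x) := by ring
  have h2 : (w - x).im < 0 := by simpa using hw
  rw [h1, Complex.log, Complex.log, norm_neg, Complex.arg_neg_eq_arg_add_pi_of_im_neg h2]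
  push_cast
  ring

include hγ hA in
-- Along the contour the usable branch is log(x - w), cut along [x, ∞). Near the two ends it differs
-- from log(w - x), whose increments tend to 0, by -πi above the axis and +πi below. The mismatch
-- -2πi is the residue contribution, with the sign of a clockwise turn.
theorem integral_gaussian_div_sub_of_avoids {x : ℝ}
    (hx : ∀ t, (x : ℂ) - γ t ∈ Complex.slitPlane) :
    ∫ t, cubicExp 0 (-A) B (γ t) * deriv γ t / (γ t - x)
      = -(2 * Real.pi * Complex.I) * cubicExp 0 (-A) B x := by
  obtain ⟨K, hK, hK'⟩ := exists_log_primitive (differentiable_cubicExp 0 (-A) B) (x : ℂ)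
  obtain ⟨T, S, hT, hS, hT', hS'⟩ := hγ.exists_balanced_far
  have hslit : ∀ w : ℂ, (x : ℂ).re < w.re → w - x ∈ Complex.slitPlane := fun w hw => by
    rw [Complex.mem_slitPlane_iff]
    left
    simpa using hw
  have hlim := (tendsto_sub_of_farRegion hA (fun w hw => hK w (hslit w hw))
    (hT'.mono fun _ h => h.1) (hS'.mono fun _ h => h.1)).add_const
      (-(2 * Real.pi * Complex.I) * cubicExp 0 (-A) B x)
  rw [zero_add] at hlim
  refine hγ.integral_div_sub_eq_of_tendsto (hγ.integrable_gaussian hA) ?_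
    (fun t => hK' _ (hx t)) hT hS (hlim.congr' ?_)
  · rintro ⟨t, ht⟩
    exact Complex.slitPlane_ne_zero (hx t) (by rw [ht, sub_self])
  · filter_upwards [hT', hS'] with n h1 h2
    rw [log_real_sub_of_im_pos h1.2, log_real_sub_of_im_neg h2.2]
    ring

include hγ hA in
-- The transform plus 2πi times the Gaussian is holomorphic off the contour and vanishes on a real
-- ray; the path from p to that ray carries the vanishing back to p.
theorem integral_gaussian_div_sub_of_onRight {p : ℂ} (hp : OnRight γ p) :
    ∫ t, cubicExp 0 (-A) B (γ t) * deriv γ t / (γ t - p)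
      = -(2 * Real.pi * Complex.I) * cubicExp 0 (-A) B p := by
  have hev := hγ.eventually_avoids
  obtain ⟨x₀, hx₀⟩ := eventually_atTop.1 hev
  obtain ⟨x, hx, hpx⟩ := ((eventually_gt_atTop x₀).and hp).exists
  have hd := (differentiableOn_cauchyTransform hγ.continuous hγ.isClosed_range
    (hγ.integrable_gaussian (B := B) hA)).add
      (((differentiable_cubicExp 0 (-A) B).const_mul (2 * Real.pi * Complex.I)).differentiableOn)
  have h0 := eq_zero_of_joinedIn hγ.isClosed_range.isOpen_compl hd hpx ?_
  · simp only [Pi.add_apply] at h0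
    rw [eq_neg_of_add_eq_zero_left h0, neg_mul]
  · have h1 : Tendsto (fun y : ℝ => (y : ℂ)) (𝓝[>] x) (𝓝[≠] (x : ℂ)) := by
      refine tendsto_nhdsWithin_iff.2
        ⟨(Complex.continuous_ofReal.tendsto x).mono_left nhdsWithin_le_nhds, ?_⟩
      filter_upwards [self_mem_nhdsWithin] with y hy
      simpa using (ne_of_gt hy)
    refine h1.frequently (Eventually.frequently ?_)
    filter_upwards [self_mem_nhdsWithin] with y hy
    simp only [Pi.add_apply]
    rw [integral_gaussian_div_sub_of_avoids hγ hA (hx₀ y (hx.trans hy).le)]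
    ring

include hγ hre hA in
theorem integral_gaussian_div_sub_div_sub_of_onRight {p q : ℂ} (hp : OnRight γ p)
    (hq : OnLeft γ q) :
    ∫ t, cubicExp 0 (-A) B (γ t) * deriv γ t / (γ t - p) / (γ t - q)
      = -(2 * Real.pi * Complex.I) * cubicExp 0 (-A) B p / (p - q) := by
  have h1 := integral_gaussian_div_sub_of_onRight hγ hA (B := B) hp
  have h2 := integral_gaussian_div_sub_of_onLeft hγ hre hA (B := B) hq
  -- At a common point the transform would be both zero and a nonzero multiple of an exponential.
  have hpq : p ≠ q := by
    rintro rfl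
    rw [h1, mul_eq_zero] at h2
    refine h2.elim (fun h => ?_) (cubicExp_ne_zero _ _ _ _)
    simp [Real.pi_ne_zero] at h
  rw [integral_gaussian_div_sub_div_sub_of_ne hγ hA hp.notMem hq.notMem hpq, h1, h2, sub_zero]

end Right

/-! ### Determinants with one distinguished index -/

section Border

variable {κ : Type} [Fintype κ] [DecidableEq κ]

theorem det_option_of_row_eq_zero (C : Matrix (Option κ) (Option κ) ℂ)
    (h : ∀ z, C none (some z) = 0) : C.det = C none none * (C.submatrix some some).det := by
  rw [← Matrix.det_submatrix_equiv_self (Equiv.optionEquivSumPUnit.{0, 0} κ).symm C]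
  have : C.submatrix (Equiv.optionEquivSumPUnit.{0, 0} κ).symm (Equiv.optionEquivSumPUnit.{0, 0} κ).symm
      = Matrix.fromBlocks (C.submatrix some some) (Matrix.of fun x _ => C (some x) none) 0
        (Matrix.of fun _ _ => C none none) := by
    ext (x | x) (y | y) <;> simp [h]
  rw [this, Matrix.det_fromBlocks_zero₂₁, Matrix.det_unique (n := PUnit)]
  simp [mul_comm]

/-- Expansion along the row and then the column of `none`. It isolates the factors A(none, y) and
A(x, none), the only ones depending on the distinguished variable when `A` is a link matrix. -/
theorem det_option (A : Matrix (Option κ) (Option κ) ℂ) (h : A none none = 0) :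
    A.det = -∑ y, A none (some y) *
      ∑ x, A (some x) none * (A.submatrix some some).adjugate y x := by
  rw [Matrix.det_eq_sum_mul_adjugate_row A none, Fintype.sum_option, h, zero_mul, zero_add,
    ← Finset.sum_neg_distrib]
  refine Finset.sum_congr rfl fun y _ => ?_
  have h1 : ∑ x, A (some x) none * (A.submatrix some some).adjugate y x
      = ((A.submatrix some some).updateCol y fun x => A (some x) none).det := by
    rw [← Matrix.cramer_apply, Matrix.cramer_eq_adjugate_mulVec]
    simp [Matrix.mulVec, dotProduct, mul_comm]
  rw [h1, Matrix.adjugate_apply, ← mul_neg]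
  congr 1
  set B := A.updateRow none (Pi.single (some y) 1) with hB
  -- Swapping the columns `none` and `some y` turns the cofactor into a minor with column y
  -- replaced; the swap is the source of the minus sign.
  have h2 := Matrix.det_permute' (Equiv.swap none (some y)) B
  rw [Equiv.Perm.sign_swap (by simp)] at h2
  rw [det_option_of_row_eq_zero] at h2
  · have h3 : (B.submatrix id (Equiv.swap none (some y))) none none = 1 := by simp [hB]
    have h4 : (B.submatrix id (Equiv.swap none (some y))).submatrix some some
        = (A.submatrix some some).updateCol y fun x => A (some x) none := by
      ext x z
      by_cases hz : z = y
      · subst hz; simp [hB]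
      · rw [Matrix.updateCol_ne hz]
        simp [hB, Equiv.swap_apply_of_ne_of_ne, hz]
    rw [h3, h4] at h2
    rw [one_mul] at h2
    rw [h2]
    simp
  · intro z
    by_cases hz : z = y
    · subst hz; simp [hB]
    · simp [hB, Equiv.swap_apply_of_ne_of_ne, hz]

end Border

/-! ### Multiple contour integrals -/

section Measure

variable {ι κ : Type} [Fintype ι] [Fintype κ]

/-- Separating the coordinate `none`. -/
def optionConsEquiv (κ : Type) : (κ → ℝ) × ℝ ≃ᵐ (Option κ → ℝ) where
  toFun p o := o.elim p.2 p.1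
  invFun t := (fun x => t (some x), t none)
  left_inv _ := rfl
  right_inv t := by funext o; cases o <;> rfl
  measurable_toFun := by
    refine measurable_pi_iff.2 fun o => ?_
    cases o with
    | none => exact measurable_snd
    | some x =>
      change Measurable fun p : (κ → ℝ) × ℝ => p.1 x
      exact (measurable_pi_apply x).comp measurable_fst
  measurable_invFun := by
    refine Measurable.prodMk (measurable_pi_iff.2 fun x => ?_) ?_ <;>
    exact measurable_pi_apply _

theorem measurePreserving_optionConsEquiv :
    MeasurePreserving (optionConsEquiv κ) volume volume := by
  refine ⟨(optionConsEquiv κ).measurable, (Measure.pi_eq fun s hs => ?_).symm⟩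
  rw [MeasurableEquiv.map_apply]
  have : (optionConsEquiv κ) ⁻¹' (Set.univ.pi s)
      = (Set.univ.pi fun x => s (some x)) ×ˢ s none := by
    ext p
    simp only [Set.mem_preimage, Set.mem_univ_pi, Set.mem_prod]
    exact ⟨fun h => ⟨fun x => h (some x), h none⟩, fun h o => by cases o; exacts [h.2, h.1 _]⟩
  rw [this, Measure.volume_eq_prod, Measure.prod_prod, volume_pi, Measure.pi_pi,
    Fintype.prod_option, mul_comm]

theorem contourInt_option {γ : Option κ → ℝ → ℂ} {g : (Option κ → ℂ) → ℂ}
    (h : ContourIntegrable γ g) :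
    contourInt γ g = ∫ t : κ → ℝ, ∫ s : ℝ, pulledBack γ g (optionConsEquiv κ (t, s)) := by
  rw [contourInt, ← measurePreserving_optionConsEquiv.integral_comp
    (optionConsEquiv κ).measurableEmbedding, Measure.volume_eq_prod, integral_prod]
  exact (measurePreserving_optionConsEquiv.integrable_comp_emb
    (optionConsEquiv κ).measurableEmbedding).2 h

theorem pulledBack_reindex (e : κ ≃ ι) (γ : ι → ℝ → ℂ) (g : (ι → ℂ) → ℂ) (t : κ → ℝ) :
    pulledBack γ g (t ∘ e.symm) = pulledBack (γ ∘ e) (fun w => g (w ∘ e.symm)) t := by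
  unfold pulledBack
  congr 1
  · congr 1
    funext x
    simp
  · rw [← e.prod_comp]
    simp

theorem measurePreserving_comp_symm (e : κ ≃ ι) :
    MeasurePreserving (MeasurableEquiv.arrowCongr' e (MeasurableEquiv.refl ℝ)) volume volume :=
  volume_preserving_arrowCongr' e (MeasurableEquiv.refl ℝ) (MeasurePreserving.id _)

theorem contourInt_reindex (e : κ ≃ ι) (γ : ι → ℝ → ℂ) (g : (ι → ℂ) → ℂ) :
    contourInt γ g = contourInt (γ ∘ e) (fun w => g (w ∘ e.symm)) := by
  rw [contourInt, ← (measurePreserving_comp_symm e).integral_comp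
    (MeasurableEquiv.measurableEmbedding _)]
  exact integral_congr_ae (Eventually.of_forall fun t => pulledBack_reindex e γ g t)

theorem ContourIntegrable.reindex {γ : ι → ℝ → ℂ} {g : (ι → ℂ) → ℂ} (h : ContourIntegrable γ g)
    (e : κ ≃ ι) : ContourIntegrable (γ ∘ e) (fun w => g (w ∘ e.symm)) := by
  refine (((measurePreserving_comp_symm e).integrable_comp_emb
    (MeasurableEquiv.measurableEmbedding _)).2 h).congr (Eventually.of_forall fun t => ?_)
  exact pulledBack_reindex e γ g t

end Measure

/-! ### Products of Cauchy determinants as one determinant -/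

section Link

variable {ι κ : Type} [Fintype ι] [DecidableEq ι] [Fintype κ] [DecidableEq κ]

/-- The matrix `1 / (w_x - w_y)` restricted to the pairs for which the row label of `x` is the
column label of `y`. -/
noncomputable def linkMatrix (rl cl : ι → ℕ) (w : ι → ℂ) : Matrix ι ι ℂ :=
  Matrix.of fun x y => if rl x = cl y then 1 / (w x - w y) else 0

/-- The determinant of `linkMatrix`, weighted by one-variable functions. -/
noncomputable def linkDet (rl cl : ι → ℕ) (φ : ι → ℂ → ℂ) (w : ι → ℂ) : ℂ :=
  (linkMatrix rl cl w).det * ∏ x, φ x (w x)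

theorem linkDet_reindex (e : κ ≃ ι) (rl cl : ι → ℕ) (φ : ι → ℂ → ℂ) (w : κ → ℂ) :
    linkDet rl cl φ (w ∘ e.symm) = linkDet (rl ∘ e) (cl ∘ e) (φ ∘ e) w := by
  unfold linkDet
  congr 1
  · rw [← Matrix.det_submatrix_equiv_self e]
    congr 1
    ext x y
    simp [linkMatrix]
  · rw [← e.prod_comp]
    simp

theorem contourInt_linkDet_reindex (e : κ ≃ ι) (γ : ι → ℝ → ℂ) (rl cl : ι → ℕ)
    (φ : ι → ℂ → ℂ) :
    contourInt γ (linkDet rl cl φ)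
      = contourInt (γ ∘ e) (linkDet (rl ∘ e) (cl ∘ e) (φ ∘ e)) := by
  rw [contourInt_reindex e]
  congr 1
  funext w
  exact linkDet_reindex e rl cl φ w

theorem ContourIntegrable.linkDet_reindex {γ : ι → ℝ → ℂ} {rl cl : ι → ℕ} {φ : ι → ℂ → ℂ}
    (h : ContourIntegrable γ (linkDet rl cl φ)) (e : κ ≃ ι) :
    ContourIntegrable (γ ∘ e) (linkDet (rl ∘ e) (cl ∘ e) (φ ∘ e)) := by
  have h' := h.reindex e
  simp only [AiryD.linkDet_reindex e] at h'
  exact h'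

/-- Linked variables are at positive distance, so the determinant is bounded; what remains is a
product of integrable one-variable functions. -/
theorem contourIntegrable_linkDet {γ : ι → ℝ → ℂ} {rl cl : ι → ℕ} {φ : ι → ℂ → ℂ}
    (hγ : ∀ x, Continuous (γ x))
    (hsep : ∀ x y, rl x = cl y → ∃ δ : ℝ, 0 < δ ∧ ∀ s t, δ ≤ ‖γ x s - γ y t‖)
    (hφ : ∀ x, Integrable fun t => φ x (γ x t) * deriv (γ x) t) :
    ContourIntegrable γ (linkDet rl cl φ) := by
  choose! δ hδ0 hδ using hsep
  have hprod : Integrable fun t : ι → ℝ =>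
      ∏ x, (φ x (γ x (t x)) * deriv (γ x) (t x) / (2 * Real.pi * Complex.I)) :=
    Integrable.fintype_prod (f := fun x s =>
      φ x (γ x s) * deriv (γ x) s / (2 * Real.pi * Complex.I)) fun x => (hφ x).div_const _
  have hcont : Continuous fun t : ι → ℝ => (linkMatrix rl cl fun x => γ x (t x)).det := by
    refine Continuous.matrix_det (continuous_matrix fun x y => ?_)
    simp only [linkMatrix, Matrix.of_apply]
    split_ifs with h
    · refine Continuous.div continuous_const (((hγ x).comp (continuous_apply x)).sub
        ((hγ y).comp (continuous_apply y))) fun t h0 => ?_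
      have h1 := hδ x y h (t x) (t y)
      rw [show γ x (t x) - γ y (t y) = 0 from h0, norm_zero] at h1
      exact absurd (hδ0 x y h) (not_lt.2 h1)
    · exact continuous_const
  have hbound : ∀ t : ι → ℝ, ‖(linkMatrix rl cl fun x => γ x (t x)).det‖
      ≤ (Fintype.card ι).factorial • (∑ x, ∑ y, |(δ x y)⁻¹|) ^ Fintype.card ι := by
    intro t
    refine Matrix.det_le (abv := NormedField.toAbsoluteValue ℂ) fun x y => ?_
    change ‖linkMatrix rl cl (fun x => γ x (t x)) x y‖ ≤ _
    have h1 : |(δ x y)⁻¹| ≤ ∑ x, ∑ y, |(δ x y)⁻¹| :=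
      (Finset.single_le_sum (f := fun y => |(δ x y)⁻¹|) (fun _ _ => abs_nonneg _)
        (Finset.mem_univ y)).trans
        (Finset.single_le_sum (f := fun x => ∑ y, |(δ x y)⁻¹|)
          (fun _ _ => Finset.sum_nonneg fun _ _ => abs_nonneg _) (Finset.mem_univ x))
    refine le_trans ?_ h1
    simp only [linkMatrix, Matrix.of_apply]
    split_ifs with h
    · rw [norm_div, norm_one, one_div, abs_of_pos (inv_pos.2 (hδ0 x y h))]
      exact inv_anti₀ (hδ0 x y h) (hδ x y h _ _)
    · rw [norm_zero]
      exact abs_nonneg _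
  refine (hprod.bdd_mul hcont.aestronglyMeasurable (Eventually.of_forall hbound)).congr
    (Eventually.of_forall fun t => ?_)
  simp only [pulledBack, linkDet]
  rw [mul_assoc (Matrix.det _), ← Finset.prod_mul_distrib]
  congr 1
  refine Finset.prod_congr rfl fun x _ => ?_
  ring

/-! ### Integrating out one right variable of a link determinant -/

section Eliminate

variable {γ : Option κ → ℝ → ℂ} {rl cl : Option κ → ℕ} {φ : Option κ → ℂ → ℂ} {A B : ℝ}
  {Y : Finset κ}

omit [Fintype κ] in
-- The two poles are w_y, through the row of `none`, and w_x, through its column. The latter is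
-- always on the left, so only a w_y on the right, that is y ∈ Y, leaves a residue.
theorem integral_gaussian_mul_link (hA : 0 < A)
    (hγ : IsContour (Real.pi / 5) (γ none)) (hre : ∀ t, 0 < (γ none t).re)
    (hY : ∀ y ∈ Y, rl none = cl (some y) ∧ ∀ t, OnRight (γ none) (γ (some y) t))
    (hY' : ∀ y ∉ Y, rl none = cl (some y) → ∀ t, OnLeft (γ none) (γ (some y) t))
    (hcol : ∀ x, rl (some x) = cl none → ∀ t, OnLeft (γ none) (γ (some x) t))
    (x y : κ) (s t : ℝ) :
    (Integrable fun r => cubicExp 0 (-A) B (γ none r) * deriv (γ none) r *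
      (if rl none = cl (some y) then 1 / (γ none r - γ (some y) t) else 0) *
      (if rl (some x) = cl none then 1 / (γ (some x) s - γ none r) else 0)) ∧
    ∫ r, cubicExp 0 (-A) B (γ none r) * deriv (γ none) r *
      (if rl none = cl (some y) then 1 / (γ none r - γ (some y) t) else 0) *
      (if rl (some x) = cl none then 1 / (γ (some x) s - γ none r) else 0)
    = if y ∈ Y then -(2 * Real.pi * Complex.I) * cubicExp 0 (-A) B (γ (some y) t) *
      (if rl (some x) = cl none then 1 / (γ (some x) s - γ (some y) t) else 0) else 0 := by
  by_cases hx : rl (some x) = cl none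
  swap
  · simp [hx]
  by_cases hy : rl none = cl (some y)
  swap
  · have : y ∉ Y := fun h => hy (hY y h).1
    simp [hy, this]
  simp only [hx, hy, if_true]
  have hL := hcol x hx s
  have hrw : ∀ r, cubicExp 0 (-A) B (γ none r) * deriv (γ none) r *
      (1 / (γ none r - γ (some y) t)) * (1 / (γ (some x) s - γ none r))
      = -(cubicExp 0 (-A) B (γ none r) * deriv (γ none) r / (γ none r - γ (some y) t)
        / (γ none r - γ (some x) s)) := by
    intro r
    rw [show γ (some x) s - γ none r = -(γ none r - γ (some x) s) by ring, one_div_neg_eq_neg_one_div]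
    ring
  simp only [hrw]
  have hmem : γ (some y) t ∉ Set.range (γ none) := by
    by_cases h : y ∈ Y
    · exact ((hY y h).2 t).notMem
    · exact (hY' y h hy t).notMem
  refine ⟨(integrable_div_sub hγ.continuous (integrable_div_sub hγ.continuous
    (hγ.integrable_gaussian hA) (exists_le_norm_sub_of_notMem hγ.isClosed_range hmem))
    (exists_le_norm_sub_of_notMem hγ.isClosed_range hL.notMem)).neg, ?_⟩
  rw [integral_neg]
  split_ifs with h
  · rw [integral_gaussian_div_sub_div_sub_of_onRight hγ hre hA ((hY y h).2 t) hL,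
      show γ (some y) t - γ (some x) s = -(γ (some x) s - γ (some y) t) by ring, div_neg]
    ring
  · rw [integral_gaussian_div_sub_div_sub_of_onLeft hγ hre hA (hY' y h hy t) hL, neg_zero]

omit [Fintype κ] in
theorem linkMatrix_update_col (rl cl : κ → ℕ) (w : κ → ℂ) (y : κ) (c : ℕ) :
    linkMatrix rl (Function.update cl y c) w
      = (linkMatrix rl cl w).updateCol y
        fun x => if rl x = c then 1 / (w x - w y) else 0 := by
  ext x z
  by_cases hz : z = y
  · subst hz; simp [linkMatrix]
  · simp [linkMatrix, hz, Matrix.updateCol_ne]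

/-- For fixed y the residues replace 1/(w_x - w_none) by 1/(w_x - w_y). Summed over x against the
adjugate this is Cramer's rule for a determinant whose column y has been replaced, which is the link
determinant in which y has taken the column label of `none`. The minus signs of the expansion and of
the residue cancel. -/
theorem integral_pulledBack_linkDet_option (hA : 0 < A)
    (hγ : IsContour (Real.pi / 5) (γ none)) (hre : ∀ t, 0 < (γ none t).re)
    (hφ : φ none = cubicExp 0 (-A) B) (hne : rl none ≠ cl none)
    (hY : ∀ y ∈ Y, rl none = cl (some y) ∧ ∀ t, OnRight (γ none) (γ (some y) t))
    (hY' : ∀ y ∉ Y, rl none = cl (some y) → ∀ t, OnLeft (γ none) (γ (some y) t))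
    (hcol : ∀ x, rl (some x) = cl none → ∀ t, OnLeft (γ none) (γ (some x) t))
    (t : κ → ℝ) :
    ∫ s : ℝ, pulledBack γ (linkDet rl cl φ) (optionConsEquiv κ (t, s))
      = ∑ y ∈ Y, pulledBack (fun x => γ (some x))
          (linkDet (fun x => rl (some x)) (Function.update (fun x => cl (some x)) y (cl none))
            (Function.update (fun x => φ (some x)) y fun w => φ (some y) w * φ none w)) t := by
  set w : κ → ℂ := fun x => γ (some x) (t x) with hw
  set A' := linkMatrix (fun x => rl (some x)) (fun x => cl (some x)) w with hA'
  set P : ℂ := (∏ x, φ (some x) (w x)) *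
    ∏ x, (deriv (γ (some x)) (t x) / (2 * Real.pi * Complex.I)) with hP
  have hint := integral_gaussian_mul_link hA hγ hre hY hY' hcol (B := B)
  have h1 : ∀ s : ℝ, pulledBack γ (linkDet rl cl φ) (optionConsEquiv κ (t, s))
      = ∑ y, ∑ x, (-(A'.adjugate y x * P / (2 * Real.pi * Complex.I))) *
        (cubicExp 0 (-A) B (γ none s) * deriv (γ none) s *
          (if rl none = cl (some y) then 1 / (γ none s - γ (some y) (t y)) else 0) *
          (if rl (some x) = cl none then 1 / (γ (some x) (t x) - γ none s) else 0)) := by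
    intro s
    have hdet : (linkMatrix rl cl fun k => γ k (optionConsEquiv κ (t, s) k)).det
        = -∑ y, (if rl none = cl (some y) then 1 / (γ none s - γ (some y) (t y)) else 0) *
          ∑ x, (if rl (some x) = cl none then 1 / (γ (some x) (t x) - γ none s) else 0) *
            A'.adjugate y x := by
      rw [det_option _ (by simp [linkMatrix, hne])]
      rfl
    simp only [pulledBack, linkDet]
    rw [hdet, Fintype.prod_option, Fintype.prod_option, hφ, ← Finset.sum_neg_distrib,
      Finset.sum_mul, Finset.sum_mul]
    refine Finset.sum_congr rfl fun y _ => ?_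
    rw [Finset.mul_sum, ← Finset.sum_neg_distrib, Finset.sum_mul, Finset.sum_mul]
    refine Finset.sum_congr rfl fun x _ => ?_
    simp only [optionConsEquiv, MeasurableEquiv.coe_mk, Equiv.coe_fn_mk, Option.elim]
    rw [hP, hw]
    ring
  simp only [h1]
  rw [integral_finsetSum _ fun y _ => integrable_finsetSum _ fun x _ =>
    ((hint x y (t x) (t y)).1.const_mul _)]
  rw [← Finset.sum_subset (Finset.subset_univ Y)]
  · refine Finset.sum_congr rfl fun y hy => ?_
    rw [integral_finsetSum _ fun x _ => ((hint x y (t x) (t y)).1.const_mul _)]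
    have hcramer : (A'.updateCol y
        fun x => if rl (some x) = cl none then 1 / (w x - w y) else 0).det
        = ∑ x, A'.adjugate y x * (if rl (some x) = cl none then 1 / (w x - w y) else 0) := by
      rw [← Matrix.cramer_apply, Matrix.cramer_eq_adjugate_mulVec]
      rfl
    have hφprod : ∏ x, Function.update (fun x => φ (some x)) y
        (fun w => φ (some y) w * φ none w) x (w x)
        = φ none (w y) * ∏ x, φ (some x) (w x) := by
      rw [← Finset.mul_prod_erase _ _ (Finset.mem_univ y),
        ← Finset.mul_prod_erase _ (fun x => φ (some x) (w x)) (Finset.mem_univ y),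
        Function.update_self, Finset.prod_congr rfl fun x hx => by
          rw [Function.update_of_ne (Finset.ne_of_mem_erase hx)]]
      ring
    simp only [pulledBack, linkDet]
    rw [linkMatrix_update_col, ← hw, ← hA', hcramer, hφprod, hφ, Finset.sum_mul, Finset.sum_mul]
    refine Finset.sum_congr rfl fun x _ => ?_
    rw [integral_const_mul, (hint x y (t x) (t y)).2, if_pos hy, hP]
    have hpi : (2 * Real.pi * Complex.I : ℂ) ≠ 0 := by simp [Real.pi_ne_zero]
    generalize (2 * Real.pi * Complex.I : ℂ) = c at hpi ⊢
    simp only [hw]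
    field_simp
  · intro y _ hy
    rw [integral_finsetSum _ fun x _ => ((hint x y (t x) (t y)).1.const_mul _)]
    refine Finset.sum_eq_zero fun x _ => ?_
    rw [integral_const_mul, (hint x y (t x) (t y)).2, if_neg hy, mul_zero]

/-- Moving one contour to the right: the variable `none` is replaced by the variables in `Y`,
whose contours are crossed. -/
theorem contourInt_linkDet_option (hA : 0 < A)
    (hγ : IsContour (Real.pi / 5) (γ none)) (hre : ∀ t, 0 < (γ none t).re)
    (hφ : φ none = cubicExp 0 (-A) B) (hne : rl none ≠ cl none)
    (hY : ∀ y ∈ Y, rl none = cl (some y) ∧ ∀ t, OnRight (γ none) (γ (some y) t))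
    (hY' : ∀ y ∉ Y, rl none = cl (some y) → ∀ t, OnLeft (γ none) (γ (some y) t))
    (hcol : ∀ x, rl (some x) = cl none → ∀ t, OnLeft (γ none) (γ (some x) t))
    (hint : ContourIntegrable γ (linkDet rl cl φ))
    (hint' : ∀ y ∈ Y, ContourIntegrable (fun x => γ (some x))
      (linkDet (fun x => rl (some x)) (Function.update (fun x => cl (some x)) y (cl none))
        (Function.update (fun x => φ (some x)) y fun w => φ (some y) w * φ none w))) :
    contourInt γ (linkDet rl cl φ)
      = ∑ y ∈ Y, contourInt (fun x => γ (some x))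
          (linkDet (fun x => rl (some x)) (Function.update (fun x => cl (some x)) y (cl none))
            (Function.update (fun x => φ (some x)) y fun w => φ (some y) w * φ none w)) := by
  rw [contourInt_option hint]
  simp only [integral_pulledBack_linkDet_option hA hγ hre hφ hne hY hY' hcol]
  exact integral_finsetSum _ hint'

end Eliminate

end Link

/-! ### The contour system -/

section Contours

variable {M : ℕ} (Γ : ContourSystem M)

theorem pos_ne_pos {i j : Fin (M + 1)} (h : i ≠ j) (a b : Bool) : pos a i ≠ pos b j := by
  have h' : (i : ℕ) ≠ j := fun h' => h (Fin.ext h')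
  cases a <;> cases b <;> simp [pos, Fin.ext_iff] <;> omega

theorem ContourSystem.isContour_left (b : Bool) (i : Fin (M + 1)) :
    IsContour (2 * Real.pi / 3) (Γ.left b i) := Γ.isContour_L _

theorem ContourSystem.isContour_right (b : Bool) (i : Fin (M + 1)) :
    IsContour (Real.pi / 5) (Γ.right b i) := Γ.isContour_R _

theorem ContourSystem.left_re (b : Bool) (i : Fin (M + 1)) (t : ℝ) : (Γ.left b i t).re < 0 :=
  Γ.re_L _ t

theorem ContourSystem.right_re (b : Bool) (i : Fin (M + 1)) (t : ℝ) : 0 < (Γ.right b i t).re :=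
  Γ.re_R _ t

/-- The two contours are at a positive distance from each other. -/
def Separated (γ γ' : ℝ → ℂ) : Prop := ∃ δ : ℝ, 0 < δ ∧ ∀ s t, δ ≤ ‖γ s - γ' t‖

theorem Separated.symm {γ γ' : ℝ → ℂ} (h : Separated γ γ') : Separated γ' γ := by
  obtain ⟨δ, hδ, h⟩ := h
  exact ⟨δ, hδ, fun s t => by rw [norm_sub_rev]; exact h t s⟩

theorem ContourSystem.separated_left {i j : Fin (M + 1)} (h : i ≠ j) (a b : Bool) :
    Separated (Γ.left a i) (Γ.left b j) := by
  rcases lt_or_gt_of_ne (pos_ne_pos h a b) with h' | h'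
  · exact (Γ.order_L _ _ h').separated
  · exact Separated.symm (Γ.order_L _ _ h').separated

theorem ContourSystem.separated_right {i j : Fin (M + 1)} (h : i ≠ j) (a b : Bool) :
    Separated (Γ.right a i) (Γ.right b j) := by
  rcases lt_or_gt_of_ne (pos_ne_pos h a b) with h' | h'
  · exact Separated.symm (Γ.order_R _ _ h').separated
  · exact (Γ.order_R _ _ h').separated

theorem IsContour.tendsto_abs_re {θ : ℝ} {γ : ℝ → ℂ} (hγ : IsContour θ γ)
    (hθ : Real.cos θ ≠ 0) : Tendsto (fun t => |(γ t).re|) (cocompact ℝ) atTop := by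
  have key : ∀ {l : Filter ℝ} {e : ℂ}, Tendsto (fun t => ‖γ t‖) l atTop →
      Tendsto (fun t => γ t / (‖γ t‖ : ℂ)) l (𝓝 e) → e.re ≠ 0 →
      Tendsto (fun t => |(γ t).re|) l atTop := by
    intro l e hn hd he
    have h1 := ((Complex.continuous_re.tendsto _).comp hd).abs
    refine (hn.atTop_mul_pos (abs_pos.2 he) h1).congr' ?_
    filter_upwards [hn.eventually_gt_atTop 0] with t ht
    simp only [Function.comp, Complex.div_ofReal_re]
    rw [abs_div, abs_of_pos ht]
    field_simp
  rw [cocompact_eq_atBot_atTop]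
  refine Tendsto.sup (key hγ.norm_atBot hγ.dir_atBot ?_) (key hγ.norm_atTop hγ.dir_atTop ?_)
  · simpa using (exp_neg_mul_I_pow_re θ 1).trans_ne (by simpa using hθ)
  · simpa using (exp_mul_I_pow_re θ 1).trans_ne (by simpa using hθ)

/-- The real part of γ is nonzero and grows at both ends, so it is bounded away from 0; nothing
beyond its sign is needed of γ'. -/
theorem separated_of_re_neg_of_re_pos {θ : ℝ} {γ γ' : ℝ → ℂ} (hγ : IsContour θ γ)
    (hθ : Real.cos θ ≠ 0) (hre : ∀ t, (γ t).re < 0) (hre' : ∀ t, 0 < (γ' t).re) : Separated γ γ' := by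
  have hbound : ∀ {g : ℝ → ℝ}, Continuous g → (∀ t, 0 < g t) → Tendsto g (cocompact ℝ) atTop →
      ∃ δ > 0, ∀ t, δ ≤ g t := by
    intro g hg hpos hlim
    obtain ⟨t₀, ht₀⟩ := hg.exists_forall_le hlim
    exact ⟨g t₀, hpos t₀, ht₀⟩
  obtain ⟨δ, hδ, h1⟩ := hbound (Complex.continuous_re.comp hγ.continuous).abs
    (fun t => abs_pos.2 (hre t).ne) (hγ.tendsto_abs_re hθ)
  refine ⟨δ, hδ, fun s t => (h1 s).trans ?_⟩
  have h2 := Complex.abs_re_le_norm (γ s - γ' t)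
  refine le_trans ?_ h2
  have := hre s
  have := hre' t
  simp only [Function.comp, Complex.sub_re]
  rw [abs_of_neg (hre s), abs_of_neg (by linarith)]
  linarith

theorem cos_two_pi_div_three : Real.cos (2 * Real.pi / 3) = -(1 / 2) := by
  rw [show 2 * Real.pi / 3 = Real.pi - Real.pi / 3 by ring, Real.cos_pi_sub,
    Real.cos_pi_div_three]

theorem ContourSystem.separated_left_right (a b : Bool) (i j : Fin (M + 1)) :
    Separated (Γ.left a i) (Γ.right b j) := by
  refine separated_of_re_neg_of_re_pos (Γ.isContour_left a i) ?_ (Γ.left_re a i) (Γ.right_re b j)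
  rw [cos_two_pi_div_three]
  norm_num

/-- On `out` contours a higher level lies further left, so lower levels are the ones crossed on the
way to +∞. -/
theorem ContourSystem.onRight_right {i j : Fin (M + 1)} (h : j < i) (t : ℝ) :
    OnRight (Γ.right false i) (Γ.right false j t) := by
  refine (Γ.order_R (pos false j) (pos false i) ?_).right t
  simp only [pos, Fin.lt_def] at h ⊢
  simpa using h

/-- Only `in` contours of higher levels lie to the right of an `in` contour. -/
theorem ContourSystem.onLeft_right {i j : Fin (M + 1)} {b : Bool} (h : j < i ∨ i < j ∧ b = false)
    (t : ℝ) : OnLeft (Γ.right true i) (Γ.right b j t) := by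
  refine (Γ.order_R (pos true i) (pos b j) ?_).left t
  have hi := i.isLt
  have hj := j.isLt
  rcases h with h | ⟨h, rfl⟩
  · cases b <;> simp only [pos, Fin.lt_def] at h ⊢ <;> simp <;> omega
  · simp only [pos, Fin.lt_def] at h ⊢
    simp
    omega

theorem ContourSystem.onLeft_left (a b : Bool) (i j : Fin (M + 1)) (t : ℝ) :
    OnLeft (Γ.right a i) (Γ.left b j t) :=
  onLeft_of_re_neg (Γ.right_re a i) (Γ.left_re b j t)

end Contours

/-! ### The weights -/

section Weights

variable {M : ℕ} (α β : Fin (M + 1) → ℝ)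

theorem f_eq_cubicExp (i : Fin (M + 1)) :
    f (fun _ => 1) α β i = cubicExp (-(1 / 3)) (α i) (β i) := by
  funext w
  simp only [f, cubicExp]
  congr 1
  push_cast
  ring

theorem cubicExp_div_cubicExp (a b d a' b' d' : ℝ) (w : ℂ) :
    cubicExp a b d w / cubicExp a' b' d' w = cubicExp (a - a') (b - b') (d - d') w := by
  simp only [cubicExp, ← Complex.exp_sub]
  congr 1
  push_cast
  ring

/-- In the direction 2π/3 both kinds of weight decay: cos 2π = 1 meets the cubic coefficient -1/3,
and cos(4π/3) = -1/2 meets a positive quadratic coefficient. -/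
theorem exists_F_eq_cubicExp {α : Fin (M + 1) → ℝ} (hα : StrictMono α) (i : Fin (M + 1)) :
    ∃ a b d : ℝ, F (fun _ => 1) α β i = cubicExp a b d ∧
      (a * Real.cos (3 * (2 * Real.pi / 3)) < 0 ∨
        a = 0 ∧ b * Real.cos (2 * (2 * Real.pi / 3)) < 0) := by
  cases i using Fin.cases with
  | zero =>
    refine ⟨-(1 / 3), α 0, β 0, ?_, Or.inl ?_⟩
    · funext w
      simp [F, f_eq_cubicExp]
    · rw [show 3 * (2 * Real.pi / 3) = 2 * Real.pi by ring, Real.cos_two_pi]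
      norm_num
  | succ j =>
    refine ⟨0, α j.succ - α j.castSucc, β j.succ - β j.castSucc, ?_, Or.inr ⟨rfl, ?_⟩⟩
    · funext w
      simp [F, f_eq_cubicExp, cubicExp_div_cubicExp]
    · rw [Real.cos_two_mul, cos_two_pi_div_three]
      have := hα j.castSucc_lt_succ
      linarith

/-- `f_{i-1}`, with `f_0 = 1`. -/
noncomputable def fPrev (i : Fin (M + 1)) (w : ℂ) : ℂ :=
  Fin.cases (motive := fun _ => ℂ) 1 (fun j : Fin M => f (fun _ => 1) α β j.castSucc w) i

/-- The cubic terms cancel, and A = α_c - α_{r-1} is positive because r - 1 < c. -/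
theorem exists_fPrev_div_f_eq {α : Fin (M + 1) → ℝ} (hα : StrictMono α) {r c : Fin (M + 1)}
    (hr : r ≠ 0) (h : r ≤ c) :
    ∃ A B : ℝ, 0 < A ∧
      (fun w => fPrev α β r w / f (fun _ => 1) α β c w) = cubicExp 0 (-A) B := by
  obtain ⟨j, rfl⟩ := Fin.exists_succ_eq_of_ne_zero hr
  refine ⟨α c - α j.castSucc, β j.castSucc - β c, sub_pos.2 (hα (j.castSucc_lt_succ.trans_le h)),
    ?_⟩
  funext w
  simp [fPrev, f_eq_cubicExp, cubicExp_div_cubicExp]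

/-- The angle π/5 lies between π/6 and π/4, so exp(w³/3) decays along it (the case r = 0) and so do
Gaussians (the other case). -/
theorem exists_fPrev_div_f_eq_cubicExp {α : Fin (M + 1) → ℝ} (hα : StrictMono α)
    {r c : Fin (M + 1)} (h : r ≤ c) :
    ∃ a b d : ℝ, (fun w => fPrev α β r w / f (fun _ => 1) α β c w) = cubicExp a b d ∧
      (a * Real.cos (3 * (Real.pi / 5)) < 0 ∨ a = 0 ∧ b * Real.cos (2 * (Real.pi / 5)) < 0) := by
  have hpi := Real.pi_pos
  by_cases hr : r = 0
  · subst hr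
    refine ⟨1 / 3, -α c, -β c, ?_, Or.inl ?_⟩
    · funext w
      simp only [fPrev, f_eq_cubicExp, Fin.cases_zero, cubicExp, one_div, ← Complex.exp_neg]
      congr 1
      push_cast
      ring
    · have : Real.cos (3 * (Real.pi / 5)) < 0 :=
        Real.cos_neg_of_pi_div_two_lt_of_lt (by linarith) (by linarith)
      linarith
  · obtain ⟨A, B, hA, he⟩ := exists_fPrev_div_f_eq β hα hr h
    refine ⟨0, -A, B, he, Or.inr ⟨rfl, ?_⟩⟩
    have : 0 < Real.cos (2 * (Real.pi / 5)) :=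
      Real.cos_pos_of_mem_Ioo ⟨by linarith, by linarith⟩
    nlinarith

theorem f_ne_zero (i : Fin (M + 1)) (w : ℂ) : f (fun _ => 1) α β i w ≠ 0 := Complex.exp_ne_zero _

theorem fPrev_succ {i c : Fin (M + 1)} (h : (c : ℕ) + 1 = i) (w : ℂ) :
    fPrev α β i w = f (fun _ => 1) α β c w := by
  cases i using Fin.cases with
  | zero => simp at h
  | succ j =>
    have : c = j.castSucc := Fin.ext (by simpa using h)
    simp [fPrev, this]

end Weights

/-! ### Particle configurations

The right variables are indexed by `S`; the variable `s` carries the weight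
`f_{row s - 1} / f_{col s}` and is linked to the other variables through the labels `row s`,
`col s`. -/

section Configuration

variable {M : ℕ} (Γ : ContourSystem M) (α β : Fin (M + 1) → ℝ) (n : Fin (M + 1) → ℕ)
variable {S T : Type} [Fintype S] [DecidableEq S] [Fintype T] [DecidableEq T]

/-- Row labels of a configuration. -/
def rowLabel (row : S → Fin (M + 1)) : Var n ⊕ S → ℕ :=
  Sum.elim (fun k => (k.1 : ℕ) + 1) (fun s => row s)

/-- Column labels of a configuration. -/
def colLabel (col : S → Fin (M + 1)) : Var n ⊕ S → ℕ :=
  Sum.elim (fun k => (k.1 : ℕ)) (fun s => (col s : ℕ) + 1)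

/-- Weights of a configuration. -/
noncomputable def confWeight (row col : S → Fin (M + 1)) : Var n ⊕ S → ℂ → ℂ :=
  Sum.elim (fun k => F (fun _ => 1) α β k.1)
    (fun s w => fPrev α β (row s) w / f (fun _ => 1) α β (col s) w)

/-- Contours of a configuration. -/
def confContour (a : Var n → Bool) (b : S → Bool) (row : S → Fin (M + 1)) :
    Var n ⊕ S → ℝ → ℂ :=
  Sum.elim (fun k => Γ.left (a k) k.1) (fun s => Γ.right (b s) (row s))

/-- The integrand of a configuration. -/
noncomputable def confDet (row col : S → Fin (M + 1)) : (Var n ⊕ S → ℂ) → ℂ :=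
  linkDet (rowLabel n row) (colLabel n col) (confWeight α β n row col)

/-- The condition row ≤ col makes linked right variables have different row labels, hence separated
contours; linked left variables have different levels. -/
theorem contourIntegrable_confDet (hα : StrictMono α) (a : Var n → Bool) (b : S → Bool)
    {row col : S → Fin (M + 1)} (h : ∀ s, row s ≤ col s) :
    ContourIntegrable (confContour Γ n a b row) (confDet α β n row col) := by
  refine contourIntegrable_linkDet ?_ ?_ ?_
  · rintro (k | s)
    · exact (Γ.isContour_left _ _).continuous
    · exact (Γ.isContour_right _ _).continuous
  · rintro (k | s) (k' | s') he
    · refine Γ.separated_left (fun h' => ?_) _ _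
      simp only [rowLabel, colLabel, Sum.elim_inl, h'] at he
      omega
    · exact Γ.separated_left_right _ _ _ _
    · exact (Γ.separated_left_right _ _ _ _).symm
    · refine Γ.separated_right (fun h' => ?_) _ _
      have h1 : (row s' : ℕ) ≤ col s' := h s'
      simp only [rowLabel, colLabel, Sum.elim_inr, h'] at he
      omega
  · rintro (k | s)
    · obtain ⟨a', b', d', he, hdec⟩ := exists_F_eq_cubicExp β hα k.1
      simp only [confWeight, confContour, Sum.elim_inl, he]
      exact (Γ.isContour_left _ _).integrable_mul_deriv (differentiable_cubicExp _ _ _).continuous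
        ((Γ.isContour_left _ _).norm_cubicExp_le hdec)
    · obtain ⟨a', b', d', he, hdec⟩ := exists_fPrev_div_f_eq_cubicExp β hα (h s)
      simp only [confWeight, confContour, Sum.elim_inr, fun w => congrFun he w]
      exact (Γ.isContour_right _ _).integrable_mul_deriv
        (differentiable_cubicExp _ _ _).continuous
        ((Γ.isContour_right _ _).norm_cubicExp_le hdec)

/-- The integral of a configuration. -/
noncomputable def confInt (a : Var n → Bool) (b : S → Bool) (row col : S → Fin (M + 1)) : ℂ :=
  contourInt (confContour Γ n a b row) (confDet α β n row col)

theorem confInt_reindex (e : T ≃ S) (a : Var n → Bool) (b : S → Bool)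
    (row col : S → Fin (M + 1)) :
    confInt Γ α β n a b row col = confInt Γ α β n a (b ∘ e) (row ∘ e) (col ∘ e) := by
  rw [confInt, confDet, contourInt_linkDet_reindex ((Equiv.refl (Var n)).sumCongr e), confInt,
    confDet]
  congr 1
  · funext x; cases x <;> rfl
  · congr 1
    · funext x; cases x <;> rfl
    · funext x; cases x <;> rfl
    · funext x; cases x <;> rfl

/-- Separating the right variable `none`. -/
def sumOptionEquiv (V S : Type) : Option (V ⊕ S) ≃ V ⊕ Option S where
  toFun o := o.elim (Sum.inr none) (Sum.map id some)
  invFun := Sum.elim (fun v => some (Sum.inl v)) fun o => o.elim none fun s => some (Sum.inr s)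
  left_inv o := by rcases o with _ | (_ | _) <;> rfl
  right_inv x := by rcases x with _ | (_ | _) <;> rfl

variable {α}

/-- A right variable on an `in` contour, beyond which there is no pole, integrates to zero. -/
theorem confInt_eq_zero (hα : StrictMono α) (a : Var n → Bool) {b : Option S → Bool}
    {row : Option S → Fin (M + 1)} (hb : b none = true) (h0 : row none ≠ 0)
    (hmax : ∀ s, row none < row (some s) → b (some s) = false) :
    confInt Γ α β n a b row row = 0 := by
  obtain ⟨A, B, hA, he⟩ := exists_fPrev_div_f_eq β hα h0 (le_refl (row none))
  have hint := contourIntegrable_confDet Γ α β n hα a b (col := row) fun s => le_rfl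
  rw [confInt, confDet, contourInt_linkDet_reindex (sumOptionEquiv (Var n) S)]
  -- No contour is crossed, so the sum of residues is empty.
  rw [contourInt_linkDet_option (A := A) (B := B) (Y := ∅) hA]
  · rfl
  · exact Γ.isContour_right _ _
  · exact Γ.right_re _ _
  · exact he
  · change (row none : ℕ) ≠ row none + 1
    omega
  · simp
  · rintro (k | s) - hs t
    · exact Γ.onLeft_left _ _ _ _ _
    · change OnLeft (Γ.right (b none) (row none)) (Γ.right (b (some s)) (row (some s)) t)
      rw [hb]
      refine Γ.onLeft_right (Or.inl ?_) t
      change (row none : ℕ) = row (some s) + 1 at hs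
      rw [Fin.lt_def]
      omega
  · rintro (k | s) hs t
    · exact Γ.onLeft_left _ _ _ _ _
    · change OnLeft (Γ.right (b none) (row none)) (Γ.right (b (some s)) (row (some s)) t)
      rw [hb]
      change (row (some s) : ℕ) = row none + 1 at hs
      have : row none < row (some s) := by rw [Fin.lt_def]; omega
      exact Γ.onLeft_right (Or.inr ⟨this, hmax s this⟩) t
  · exact hint.linkDet_reindex (sumOptionEquiv (Var n) S)
  · simp

/-- Moving the contour of the right variable `none` to infinity, crossing the contours of the
variables it can be linked to. -/
theorem confInt_option (hα : StrictMono α) {row col : Option S → Fin (M + 1)}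
    (h : ∀ s, row s ≤ col s) (h0 : row none ≠ 0) (hmax : ∀ s, row (some s) ≤ row none) :
    confInt Γ α β n (fun _ => true) (fun _ => false) row col
      = ∑ s ∈ Finset.univ.filter (fun s : S => (row none : ℕ) = col (some s) + 1),
        confInt Γ α β n (fun _ => true) (fun _ => false) (fun s => row (some s))
          (Function.update (fun s => col (some s)) s (col none)) := by
  obtain ⟨A, B, hA, he⟩ := exists_fPrev_div_f_eq β hα h0 (h none)
  have hint := contourIntegrable_confDet Γ α β n hα (fun _ => true) (fun _ => false) h
  have hle : ∀ s : S, (row none : ℕ) = col (some s) + 1 →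
      ∀ s', row (some s') ≤ Function.update (fun s => col (some s)) s (col none) s' := by
    intro s _ s'
    by_cases hs' : s' = s
    · subst hs'
      rw [Function.update_self]
      exact (hmax s').trans (h none)
    · rw [Function.update_of_ne hs']
      exact h _
  have hcl : ∀ s : S, Function.update
      (fun x => (colLabel n col ∘ sumOptionEquiv (Var n) S) (some x)) (Sum.inr s)
        ((colLabel n col ∘ sumOptionEquiv (Var n) S) none)
      = colLabel n (Function.update (fun s => col (some s)) s (col none)) := by
    intro s
    funext x
    rcases x with k | s'
    · simp [colLabel, sumOptionEquiv]
    · by_cases hs' : s' = s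
      · subst hs'; simp [colLabel, sumOptionEquiv]
      · simp [colLabel, sumOptionEquiv, hs']
  -- The merged weight telescopes: f_{row s - 1}/f_{col s} times f_{row none - 1}/f_{col none},
  -- where row none - 1 = col s.
  have hw : ∀ s : S, (row none : ℕ) = col (some s) + 1 → Function.update
      (fun x => (confWeight α β n row col ∘ sumOptionEquiv (Var n) S) (some x)) (Sum.inr s)
        (fun w => (confWeight α β n row col ∘ sumOptionEquiv (Var n) S) (some (Sum.inr s)) w *
          (confWeight α β n row col ∘ sumOptionEquiv (Var n) S) none w)
      = confWeight α β n (fun s => row (some s))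
          (Function.update (fun s => col (some s)) s (col none)) := by
    intro s hs
    funext x w
    rcases x with k | s'
    · simp [confWeight, sumOptionEquiv]
    · by_cases hs' : s' = s
      · subst hs'
        simp only [confWeight, sumOptionEquiv, Function.comp, Function.update_self,
          Equiv.coe_fn_mk, Option.elim, Sum.elim_inr, Sum.map_inr]
        rw [fPrev_succ α β hs.symm]
        have := f_ne_zero α β (col (some s')) w
        field_simp
      · simp [confWeight, sumOptionEquiv, hs']
  rw [confInt, confDet, contourInt_linkDet_reindex (sumOptionEquiv (Var n) S)]
  rw [contourInt_linkDet_option (A := A) (B := B)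
    (Y := (Finset.univ.filter (fun s : S => (row none : ℕ) = col (some s) + 1)).map
      Function.Embedding.inr) hA]
  · rw [Finset.sum_map]
    refine Finset.sum_congr rfl fun s hs => ?_
    rw [Finset.mem_filter] at hs
    rw [Function.Embedding.inr_apply, hcl, hw s hs.2, confInt, confDet]
    congr 1
    · funext x; cases x <;> rfl
    · congr 1
      funext x; cases x <;> rfl
  · exact Γ.isContour_right _ _
  · exact Γ.right_re _ _
  · exact he
  · change (row none : ℕ) ≠ col none + 1
    have : (row none : ℕ) ≤ col none := h none
    omega
  · intro y hy
    obtain ⟨s, hs, rfl⟩ := Finset.mem_map.1 hy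
    rw [Finset.mem_filter] at hs
    refine ⟨hs.2, fun t => Γ.onRight_right ?_ t⟩
    have h1 : (row (some s) : ℕ) ≤ col (some s) := h (some s)
    have h2 := hs.2
    rw [Fin.lt_def]
    omega
  · rintro (k | s) hy hs t
    · exact Γ.onLeft_left _ _ _ _ _
    · refine absurd ?_ hy
      exact Finset.mem_map.2 ⟨s, Finset.mem_filter.2 ⟨Finset.mem_univ _, hs⟩, rfl⟩
  -- A right variable linked through the column of `none` would have row label col none + 1 > row
  -- none, against maximality.
  · rintro (k | s) hs t
    · exact Γ.onLeft_left _ _ _ _ _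
    · change (row (some s) : ℕ) = col none + 1 at hs
      have h1 : (row (some s) : ℕ) ≤ row none := hmax s
      have h2 : (row none : ℕ) ≤ col none := h none
      omega
  · exact hint.linkDet_reindex (sumOptionEquiv (Var n) S)
  · intro y hy
    obtain ⟨s, hs, rfl⟩ := Finset.mem_map.1 hy
    rw [Finset.mem_filter] at hs
    rw [Function.Embedding.inr_apply, hcl, hw s hs.2]
    have := contourIntegrable_confDet Γ α β n hα (fun _ => true) (fun _ => false) (hle s hs.2)
    convert this using 1
    · funext x; cases x <;> rfl
    · rw [confDet]
      congr 1
      funext x; cases x <;> rfl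

end Configuration

/-! ### Label counts -/

section Counting

variable {M : ℕ} {S T : Type} [Fintype S] [DecidableEq S] [Fintype T] [DecidableEq T]

/-- The number of elements with a given label. -/
def labelCount (c : S → Fin (M + 1)) (j : Fin (M + 1)) : ℕ := ∑ s, if c s = j then 1 else 0

omit [DecidableEq S] [DecidableEq T] in
theorem labelCount_comp_equiv (e : T ≃ S) (c : S → Fin (M + 1)) (j : Fin (M + 1)) :
    labelCount (c ∘ e) j = labelCount c j :=
  e.sum_comp fun s => if c s = j then 1 else 0

omit [DecidableEq S] in
theorem labelCount_option (c : Option S → Fin (M + 1)) (j : Fin (M + 1)) :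
    labelCount c j = (if c none = j then 1 else 0) + labelCount (fun s => c (some s)) j :=
  Fintype.sum_option _

theorem labelCount_update (c : S → Fin (M + 1)) (s : S) (v j : Fin (M + 1)) :
    labelCount (Function.update c s v) j + (if c s = j then 1 else 0)
      = labelCount c j + if v = j then 1 else 0 := by
  unfold labelCount
  rw [← Finset.add_sum_erase _ _ (Finset.mem_univ s),
    ← Finset.add_sum_erase _ (fun s => if c s = j then 1 else 0) (Finset.mem_univ s),
    Function.update_self, Finset.sum_congr rfl fun x hx => by
      rw [Function.update_of_ne (Finset.ne_of_mem_erase hx)]]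
  ring

omit [DecidableEq S] in
theorem labelCount_eq_card (c : S → Fin (M + 1)) (j : Fin (M + 1)) :
    labelCount c j = Fintype.card {s // c s = j} := by
  rw [labelCount, Fintype.card_subtype, Finset.card_filter]

theorem labelCount_fst (k : Fin (M + 1) → ℕ) (j : Fin (M + 1)) :
    labelCount (fun s : Var k => s.1) j = k j := by
  rw [labelCount, Fintype.sum_sigma]
  refine (Finset.sum_congr rfl fun x _ => (?_ : _ = if x = j then k x else 0)).trans (by simp)
  by_cases h : x = j <;> simp [h]

omit [DecidableEq T] in
theorem exists_equiv_of_labelCount {k : Fin (M + 1) → ℕ} {c : T → Fin (M + 1)}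
    (h : ∀ j, labelCount c j = k j) : ∃ e : Var k ≃ T, ∀ s, c (e s) = s.1 := by
  have e' : ∀ j, {t // c t = j} ≃ Fin (k j) := fun j =>
    Fintype.equivFinOfCardEq (by rw [← labelCount_eq_card, h])
  exact ⟨(Equiv.sigmaCongrRight fun j => (e' j).symm).trans (Equiv.sigmaFiberEquiv c),
    fun s => ((e' s.1).symm s.2).2⟩

end Counting

/-! ### Eliminating all right variables of nonzero row label -/

section Elimination

variable {M : ℕ} (Γ : ContourSystem M) {α : Fin (M + 1) → ℝ} (β : Fin (M + 1) → ℝ)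
  (n : Fin (M + 1) → ℕ)

theorem prod_descFactorial_succ {a b a' b' : Fin M → ℕ} (i : Fin M)
    (ha : ∀ j, a j = (if i = j then 1 else 0) + a' j)
    (hb : ∀ j, b j = (if i = j then 1 else 0) + b' j) :
    ∏ j, (b j).descFactorial (a j) = b i * ∏ j, (b' j).descFactorial (a' j) := by
  rw [← Finset.mul_prod_erase _ _ (Finset.mem_univ i),
    ← Finset.mul_prod_erase _ (fun j => (b' j).descFactorial (a' j)) (Finset.mem_univ i),
    ← mul_assoc]
  congr 1
  · rw [ha i, hb i, if_pos rfl, add_comm 1, add_comm 1, Nat.succ_descFactorial_succ]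
  · refine Finset.prod_congr rfl fun j hj => ?_
    rw [ha j, hb j, if_neg (Finset.ne_of_mem_erase hj).symm, zero_add, zero_add]

/-- All right variables with nonzero row label can be eliminated. -/
theorem confInt_eq_prod_descFactorial_mul (hα : StrictMono α) (C : ℂ) (N : ℕ) :
    ∀ (S : Type) [Fintype S] [DecidableEq S] (row col : S → Fin (M + 1)),
      (∀ s, row s ≤ col s) → (∑ s, if row s = 0 then 0 else 1) = N →
      (∀ (T : Type) [Fintype T] [DecidableEq T] (c : T → Fin (M + 1)),
        (∀ j : Fin M, labelCount col j.castSucc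
          = labelCount row j.succ + labelCount c j.castSucc) →
        labelCount col (Fin.last M) = labelCount c (Fin.last M) →
        confInt Γ α β n (fun _ => true) (fun _ => false) (fun _ => 0) c = C) →
      confInt Γ α β n (fun _ => true) (fun _ => false) row col
        = ((∏ j : Fin M, (labelCount col j.castSucc).descFactorial (labelCount row j.succ) : ℕ) : ℂ)
          * C := by
  induction N with
  | zero =>
    intro S _ _ row col hle hN hC
    have hrow : row = fun _ => 0 := by
      funext s
      by_contra h
      have := Finset.sum_eq_zero_iff.1 hN s (Finset.mem_univ s)
      simp [h] at this
    subst hrow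
    have h0 : ∀ j : Fin M, labelCount (fun _ : S => (0 : Fin (M + 1))) j.succ = 0 := fun j => by
      simp [labelCount, (Fin.succ_ne_zero j).symm]
    rw [hC S col (fun j => by rw [h0, zero_add]) rfl]
    simp [h0]
  | succ N ih =>
    -- separate a variable of maximal row label
    suffices H : ∀ (S : Type) [Fintype S] [DecidableEq S] (row col : Option S → Fin (M + 1)),
        (∀ s, row s ≤ col s) → row none ≠ 0 → (∀ s, row (some s) ≤ row none) →
        (∑ s, if row s = 0 then 0 else 1) = N + 1 →
        (∀ (T : Type) [Fintype T] [DecidableEq T] (c : T → Fin (M + 1)),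
          (∀ j : Fin M, labelCount col j.castSucc
            = labelCount row j.succ + labelCount c j.castSucc) →
          labelCount col (Fin.last M) = labelCount c (Fin.last M) →
          confInt Γ α β n (fun _ => true) (fun _ => false) (fun _ => 0) c = C) →
        confInt Γ α β n (fun _ => true) (fun _ => false) row col
          = ((∏ j : Fin M,
              (labelCount col j.castSucc).descFactorial (labelCount row j.succ) : ℕ) : ℂ) * C by
      intro S _ _ row col hle hN hC
      have hex : ∃ s, row s ≠ 0 := by
        by_contra hall
        push Not at hall
        simp [hall] at hN
      obtain ⟨s₁, hs₁⟩ := hex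
      obtain ⟨s₀, -, hmax⟩ := Finset.exists_max_image Finset.univ row ⟨s₁, Finset.mem_univ _⟩
      have h0 : row s₀ ≠ 0 := fun h =>
        hs₁ (Fin.le_zero_iff.1 (h ▸ hmax s₁ (Finset.mem_univ _)))
      let e := Equiv.optionSubtypeNe s₀
      have hnone : e none = s₀ := by simp [e]
      rw [confInt_reindex Γ α β n e]
      have := H {s // s ≠ s₀} (row ∘ e) (col ∘ e) (fun s => hle _)
        (by simpa only [Function.comp, hnone] using h0)
        (fun s => by simpa only [Function.comp, hnone] using hmax _ (Finset.mem_univ _))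
        ((e.sum_comp fun s => if row s = 0 then 0 else 1).trans hN)
        (by simpa only [labelCount_comp_equiv] using hC)
      simp only [labelCount_comp_equiv] at this
      exact this
    intro S _ _ row col hle h0 hmax hN hC
    obtain ⟨i, hi⟩ := Fin.exists_succ_eq_of_ne_zero h0
    rw [confInt_option Γ β n hα hle h0 hmax]
    set Y := Finset.univ.filter (fun s : S => (row none : ℕ) = col (some s) + 1) with hY
    have hmem : ∀ s, s ∈ Y ↔ col (some s) = i.castSucc := by
      intro s
      rw [hY, Finset.mem_filter, ← hi, Fin.ext_iff]
      simp [eq_comm]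
    have hcol0 : col none ≠ i.castSucc := by
      intro h
      have := hle none
      rw [h, ← hi, Fin.le_def] at this
      simp at this
    have hcard : labelCount col i.castSucc = Y.card := by
      rw [labelCount_option, if_neg hcol0, zero_add, labelCount, ← Finset.card_filter]
      congr 1
      ext s
      simp [hmem]
    have hrowCount : ∀ j : Fin M, labelCount row j.succ
        = (if i = j then 1 else 0) + labelCount (fun s => row (some s)) j.succ := by
      intro j
      rw [labelCount_option, ← hi]
      simp only [Fin.succ_inj]
    have hcolCount : ∀ s ∈ Y, ∀ j : Fin M, labelCount col j.castSucc = (if i = j then 1 else 0) +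
        labelCount (Function.update (fun s => col (some s)) s (col none)) j.castSucc := by
      intro s hs j
      have h1 := labelCount_update (fun s => col (some s)) s (col none) j.castSucc
      simp only [(hmem s).1 hs, Fin.castSucc_inj] at h1
      rw [labelCount_option, add_comm, ← h1, add_comm]
    have hlast : ∀ s ∈ Y, labelCount col (Fin.last M)
        = labelCount (Function.update (fun s => col (some s)) s (col none)) (Fin.last M) := by
      intro s hs
      have h1 := labelCount_update (fun s => col (some s)) s (col none) (Fin.last M)
      simp only [(hmem s).1 hs, (Fin.castSucc_lt_last i).ne, if_false, add_zero] at h1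
      rw [labelCount_option, add_comm, ← h1]
    have hN' : (∑ s : S, if row (some s) = 0 then 0 else 1) = N := by
      rw [Fintype.sum_option, if_neg h0] at hN
      omega
    -- Merging lowers by one both the row count at i + 1 and the column count at i, so the product
    -- of falling factorials loses exactly the factor |Y|. Hence |Y| equal summands add up to the
    -- claim.
    have hterm : ∀ s ∈ Y, (Y.card : ℂ) *
        confInt Γ α β n (fun _ => true) (fun _ => false) (fun s => row (some s))
          (Function.update (fun s => col (some s)) s (col none))
        = ((∏ j : Fin M,
            (labelCount col j.castSucc).descFactorial (labelCount row j.succ) : ℕ) : ℂ) * C := by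
      intro s hs
      rw [ih S (fun s => row (some s)) (Function.update (fun s => col (some s)) s (col none)) ?_ hN'
        ?_, prod_descFactorial_succ i hrowCount (hcolCount s hs), hcard, Nat.cast_mul, mul_assoc]
      · intro s'
        by_cases hs' : s' = s
        · subst hs'
          rw [Function.update_self]
          exact (hmax s').trans (hle none)
        · rw [Function.update_of_ne hs']
          exact hle _
      · intro T _ _ c h1 h2
        refine hC T c (fun j => ?_) ((hlast s hs).trans h2)
        rw [hcolCount s hs, h1 j, hrowCount j, add_assoc]
    -- If there is nothing to merge with, the empty sum matches a falling factorial of 0 of positive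
    -- length.
    rcases Y.eq_empty_or_nonempty with hemp | hne
    · have hz : (labelCount col i.castSucc).descFactorial (labelCount row i.succ) = 0 := by
        rw [hcard, hemp, Finset.card_empty, hrowCount i, if_pos rfl, add_comm,
          Nat.zero_descFactorial_succ]
      rw [hemp, Finset.sum_empty, Finset.prod_eq_zero (Finset.mem_univ i) hz]
      simp
    · have hY0 : (Y.card : ℂ) ≠ 0 := by exact_mod_cast hne.card_pos.ne'
      refine mul_left_cancel₀ hY0 ?_
      rw [Finset.mul_sum, Finset.sum_congr rfl hterm, Finset.sum_const, nsmul_eq_mul]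

/-- A terminal configuration would give n_i = n_{i+1} plus a count for every i, forcing n to be
antitone. The common terminal value may therefore be taken to be 0. -/
theorem confInt_fst_eq_zero_of_not_antitone (hα : StrictMono α) (hn : ¬ Antitone n) :
    confInt Γ α β n (fun _ => true) (fun _ => false) (fun k : Var n => k.1) (fun k => k.1) = 0 := by
  rw [confInt_eq_prod_descFactorial_mul Γ β n hα 0 _ (Var n) _ _ (fun s => le_rfl) rfl, mul_zero]
  intro T _ _ c h _
  refine absurd (Fin.antitone_iff_succ_le.2 fun j => ?_) hn
  have := h j
  rw [labelCount_fst, labelCount_fst] at this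
  omega

/-- The counts force every terminal configuration to have k_i variables of column label i, so all
are relabellings of `Var (gap n)`. The falling factorial of n_i of length n_{i+1} is n_i!/k_i!. -/
theorem confInt_fst_eq_of_antitone (hα : StrictMono α) (hn : Antitone n) :
    confInt Γ α β n (fun _ => true) (fun _ => false) (fun k : Var n => k.1) (fun k => k.1)
      = (∏ i : Fin M, ((n i.castSucc).factorial : ℂ) / ((gap n i.castSucc).factorial : ℂ)) *
        confInt Γ α β n (fun _ => true) (fun _ => false) (fun _ : Var (gap n) => 0)
          (fun k => k.1) := by
  rw [confInt_eq_prod_descFactorial_mul Γ β n hα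
    (confInt Γ α β n (fun _ => true) (fun _ => false) (fun _ : Var (gap n) => 0) (fun k => k.1))
    _ (Var n) _ _ (fun s => le_rfl) rfl]
  · congr 1
    push_cast
    refine Finset.prod_congr rfl fun j _ => ?_
    have h1 := gap_castSucc hn j
    have h2 := Nat.factorial_mul_descFactorial (n := n j.castSucc) (k := n j.succ) (by omega)
    rw [labelCount_fst, labelCount_fst, eq_div_iff (by exact_mod_cast Nat.factorial_ne_zero _),
      ← h2, show n j.castSucc - n j.succ = gap n j.castSucc by omega]
    push_cast
    ring
  · intro T _ _ c h h'
    have hcount : ∀ j, labelCount c j = gap n j := by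
      intro j
      refine Fin.lastCases ?_ (fun j => ?_) j
      · rw [← h', labelCount_fst, ← gap_last]
      · have h1 := h j
        have h2 := gap_castSucc hn j
        rw [labelCount_fst, labelCount_fst] at h1
        omega
    obtain ⟨e, he⟩ := exists_equiv_of_labelCount hcount
    rw [confInt_reindex Γ α β n e]
    congr 1
    funext s
    exact he s

end Elimination

/-! ### The sign of a permutation with graded cycles -/

/-- The sign of a permutation all of whose cycles increase the height by one at each step, except
when they return to their only point of height zero. -/
theorem sign_eq_of_height {X : Type} [Fintype X] [DecidableEq X] (N : ℕ) :
    ∀ (σ : Equiv.Perm X) (h : X → ℕ) (base : X → X),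
      (∀ y, h (σ y) = h y + 1 ∨ h (σ y) = 0) → (∀ y, base (σ y) = base y) →
      (∀ x, h x = 0 → base x = x) → (∑ x, if h x = 0 then 0 else 1) = N →
      Equiv.Perm.sign σ = (-1) ^ N := by
  induction N with
  | zero =>
    intro σ h base _ hb h0 hN
    have hz : ∀ x, h x = 0 := fun x => by
      by_contra hx
      have := Finset.sum_eq_zero_iff.1 hN x (Finset.mem_univ x)
      simp [hx] at this
    have : σ = 1 := by
      ext y
      have := hb y
      rwa [h0 _ (hz _), h0 _ (hz _)] at this
    simp [this]
  | succ N ih =>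
    intro σ h base ha hb h0 hN
    have hex : ∃ x, h x ≠ 0 := by
      by_contra hall
      push Not at hall
      simp [hall] at hN
    obtain ⟨x₁, hx₁⟩ := hex
    obtain ⟨x, -, hmax⟩ := Finset.exists_max_image Finset.univ h ⟨x₁, Finset.mem_univ _⟩
    have hx : h x ≠ 0 := fun h' => hx₁ (Nat.le_zero.1 (h' ▸ hmax x₁ (Finset.mem_univ _)))
    have hσx : h (σ x) = 0 := by
      rcases ha x with h' | h'
      · have := hmax (σ x) (Finset.mem_univ _)
        omega
      · exact h'
    have hne : σ x ≠ x := fun h' => hx (h' ▸ hσx)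
    have hswap : ∀ y, y ≠ x → σ y ≠ x → (Equiv.swap x (σ x) * σ) y = σ y := fun y h1 h2 => by
      rw [Equiv.Perm.mul_apply, Equiv.swap_apply_of_ne_of_ne h2 fun h3 => h1 (σ.injective h3)]
    have hx' : (Equiv.swap x (σ x) * σ) x = x := by simp
    have hpre : ∀ y, σ y = x → (Equiv.swap x (σ x) * σ) y = σ x := fun y hy => by simp [hy]
    -- A point of maximal height must return to height zero. The transposition cuts it out of its
    -- cycle, and it becomes a fixed point that is its own base, so the number of points of nonzero
    -- height drops by one.
    have key := ih (Equiv.swap x (σ x) * σ) (Function.update h x 0) (Function.update base x x)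
      ?_ ?_ ?_ ?_
    · rw [Equiv.Perm.sign_mul, Equiv.Perm.sign_swap hne.symm] at key
      rw [pow_succ, ← key]
      simp
    · intro y
      by_cases h1 : y = x
      · subst h1; rw [hx']; simp
      by_cases h2 : σ y = x
      · rw [hpre y h2, Function.update_of_ne hne, hσx]; simp
      · rw [hswap y h1 h2, Function.update_of_ne h1, Function.update_of_ne h2]
        exact ha y
    · intro y
      by_cases h1 : y = x
      · subst h1; rw [hx']
      by_cases h2 : σ y = x
      · rw [hpre y h2, Function.update_of_ne hne, Function.update_of_ne h1, hb, ← hb y, h2]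
      · rw [hswap y h1 h2, Function.update_of_ne h1, Function.update_of_ne h2]
        exact hb y
    · intro y hy
      by_cases h1 : y = x
      · subst h1; simp
      · rw [Function.update_of_ne h1] at hy ⊢
        exact h0 y hy
    · rw [← Finset.add_sum_erase _ _ (Finset.mem_univ x)] at hN ⊢
      rw [if_neg hx] at hN
      rw [Function.update_self, if_pos rfl, zero_add, Finset.sum_congr rfl fun y hy => by
        rw [Function.update_of_ne (Finset.ne_of_mem_erase hy)]]
      omega

/-! ### A link determinant as a product of blocks -/

section Blocks

variable {ι : Type} [Fintype ι] [DecidableEq ι]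

/-- Once σ matches column labels to row labels, permuting the columns by σ makes the matrix block
diagonal with one block per label. -/
theorem det_linkMatrix_eq_prod {rl cl : ι → ℕ} {σ : Equiv.Perm ι} (hσ : ∀ x, cl (σ x) = rl x)
    {K : ℕ} (hK : ∀ x, rl x < K) (w : ι → ℂ) :
    (linkMatrix rl cl w).det = Equiv.Perm.sign σ * ∏ k ∈ Finset.range K,
      (Matrix.of fun x y : {x // rl x = k} => 1 / (w x - w (σ y))).det := by
  have h1 := Matrix.det_permute' σ (linkMatrix rl cl w)
  have hsq : ((Equiv.Perm.sign σ : ℤ) : ℂ) * (Equiv.Perm.sign σ : ℤ) = 1 := by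
    rw [← Int.cast_mul, ← Units.val_mul, Int.units_mul_self]
    simp
  have h2 : (linkMatrix rl cl w).det
      = Equiv.Perm.sign σ * ((linkMatrix rl cl w).submatrix id σ).det := by
    rw [h1, ← mul_assoc, hsq, one_mul]
  rw [h2]
  congr 1
  have htri : Matrix.BlockTriangular ((linkMatrix rl cl w).submatrix id σ) rl := by
    intro x y hxy
    simp [linkMatrix, hσ, hxy.ne']
  rw [htri.det, Finset.prod_subset (s₂ := Finset.range K)]
  · refine Finset.prod_congr rfl fun k _ => ?_
    congr 1
    ext x y
    simp [Matrix.toSquareBlock_def, linkMatrix, hσ, x.2, y.2]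
  · intro k hk
    obtain ⟨x, -, rfl⟩ := Finset.mem_image.1 hk
    exact Finset.mem_range.2 (hK x)
  · intro k _ hk
    have : IsEmpty {x // rl x = k} :=
      ⟨fun x => hk (Finset.mem_image.2 ⟨x, Finset.mem_univ _, x.2⟩)⟩
    exact Matrix.det_isEmpty

theorem det_block_eq_cauchyDet {rl : ι → ℕ} {σ : Equiv.Perm ι} {w : ι → ℂ} {k p q : ℕ}
    (hpq : p = q) {W : Fin p → ℂ} {W' : Fin q → ℂ} (e : Fin p → ι) (hinj : Function.Injective e)
    (hmem : ∀ x, rl x = k ↔ ∃ i, e i = x) (hW : ∀ i, W i = w (e i))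
    (hW' : ∀ j, W' (Fin.cast hpq j) = w (σ (e j))) :
    (Matrix.of fun x y : {x // rl x = k} => 1 / (w x - w (σ y))).det = cauchyDet W W' hpq := by
  let e' : Fin p ≃ {x // rl x = k} :=
    Equiv.ofBijective (fun i => ⟨e i, (hmem _).2 ⟨i, rfl⟩⟩)
      ⟨fun i j h => hinj (congrArg Subtype.val h), fun x => by
        obtain ⟨i, hi⟩ := (hmem x).1 x.2
        exact ⟨i, Subtype.ext hi⟩⟩
  rw [← Matrix.det_submatrix_equiv_self e', cauchyDet]
  congr 1
  ext i j
  simp only [Matrix.submatrix_apply, Matrix.of_apply, hW, hW']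
  rfl

end Blocks

/-! ### Identifying the original integrand -/

section Integrands

variable {M : ℕ} (α β : Fin (M + 1) → ℝ) (n : Fin (M + 1) → ℕ)

theorem append_comp_eq {X Y : Type} {p q : ℕ} (g : X → Y) (a : Fin p → X) (b : Fin q → X)
    (i : Fin (p + q)) :
    g (Fin.append a b i) = Fin.append (fun i => g (a i)) (fun i => g (b i)) i := by
  refine Fin.addCases (fun i => ?_) (fun i => ?_) i <;> simp

theorem prod_range_blocks (g : ℕ → ℂ) :
    ∏ k ∈ Finset.range (M + 2), g k = g 0 * ((∏ i : Fin M, g (i + 1)) * g (M + 1)) := by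
  rw [Finset.prod_range_succ', Finset.prod_range_succ, Finset.prod_range, mul_comm]

theorem sum_ite_rowLabel {S : Type} [Fintype S] :
    (∑ x : Var n ⊕ S, if rowLabel n (fun _ : S => (0 : Fin (M + 1))) x = 0 then 0 else 1)
      = Fintype.card (Var n) := by
  rw [Fintype.sum_sum_type]
  simp [rowLabel]

theorem append_injective {X : Type} {p q : ℕ} {a : Fin p → X} {b : Fin q → X}
    (ha : Function.Injective a) (hb : Function.Injective b) (hab : ∀ i j, a i ≠ b j) :
    Function.Injective (Fin.append a b) :=
  Fin.append_injective_iff.2 ⟨ha, hb, hab⟩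

theorem inl_mk_injective {S : Type} (i : Fin (M + 1)) :
    Function.Injective fun l : Fin (n i) => (Sum.inl ⟨i, l⟩ : Var n ⊕ S) := fun l l' h => by
  simpa using h

theorem inr_mk_injective {V : Type} (i : Fin (M + 1)) :
    Function.Injective fun l : Fin (n i) => (Sum.inr ⟨i, l⟩ : V ⊕ Var n) := fun l l' h => by
  simpa using h

theorem fPrev_div_f (i : Fin (M + 1)) (w : ℂ) :
    fPrev α β i w / f (fun _ => 1) α β i w = (F (fun _ => 1) α β i w)⁻¹ := by
  cases i using Fin.cases with
  | zero => simp [fPrev, F]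
  | succ j => simp [fPrev, F]

/-- The matching permutation exchanges each u with the v of the same index. It is a product of `card
(Var n)` transpositions. -/
theorem confDet_fst_eq (w : Var n ⊕ Var n → ℂ) :
    confDet α β n (fun k : Var n => k.1) (fun k => k.1) w
      = (-1) ^ Fintype.card (Var n) * integrand (fun _ => 1) α β n w := by
  let σ : Equiv.Perm (Var n ⊕ Var n) := Equiv.sumComm _ _
  have hσ : ∀ x, colLabel n (fun k : Var n => k.1) (σ x) = rowLabel n (fun k : Var n => k.1) x := by
    rintro (k | k) <;> rfl
  have hK : ∀ x, rowLabel n (fun k : Var n => k.1) x < M + 2 := by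
    rintro (k | k) <;> simp only [rowLabel, Sum.elim_inl, Sum.elim_inr] <;> omega
  have hsign : Equiv.Perm.sign σ = (-1) ^ Fintype.card (Var n) := by
    refine sign_eq_of_height _ σ (Sum.elim (fun _ => 1) fun _ => 0)
      (Sum.elim (fun k => Sum.inr k) fun k => Sum.inr k) ?_ ?_ ?_ ?_
    · rintro (k | k) <;> simp [σ]
    · rintro (k | k) <;> simp [σ]
    · rintro (k | k) <;> simp
    · rw [Fintype.sum_sum_type]
      simp
  have hweights : ∏ x, confWeight α β n (fun k : Var n => k.1) (fun k => k.1) x (w x)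
      = ∏ k : Var n, F (fun _ => 1) α β k.1 (w (Sum.inl k)) /
          F (fun _ => 1) α β k.1 (w (Sum.inr k)) := by
    rw [Fintype.prod_sum_type, ← Finset.prod_mul_distrib]
    refine Finset.prod_congr rfl fun k _ => ?_
    simp only [confWeight, Sum.elim_inl, Sum.elim_inr, fPrev_div_f]
    rfl
  have hb0 : (Matrix.of fun x y : {x // rowLabel n (fun k : Var n => k.1) x = 0} =>
      1 / (w x - w (σ y))).det
      = cauchyDet (vec (fun k : Var n => w (Sum.inr k)) 0) (vec (fun k : Var n => w (Sum.inl k)) 0)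
        rfl := by
    refine det_block_eq_cauchyDet rfl (fun l => Sum.inr ⟨0, l⟩) (inr_mk_injective n 0) ?_
      (fun _ => rfl) fun _ => rfl
    rintro (⟨i, l⟩ | ⟨i, l⟩)
    · simp [rowLabel]
    · simp only [rowLabel, Sum.elim_inr, Sum.inr.injEq]
      constructor
      · intro h
        obtain rfl : i = 0 := Fin.ext h
        exact ⟨l, rfl⟩
      · rintro ⟨l', h⟩
        obtain rfl : 0 = i := congrArg Sigma.fst h
        rfl
  have hb : ∀ i : Fin M,
      (Matrix.of fun x y : {x // rowLabel n (fun k : Var n => k.1) x = (i : ℕ) + 1} =>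
        1 / (w x - w (σ y))).det
      = cauchyDet (Fin.append (vec (fun k : Var n => w (Sum.inl k)) i.castSucc)
          (vec (fun k : Var n => w (Sum.inr k)) i.succ))
        (Fin.append (vec (fun k : Var n => w (Sum.inr k)) i.castSucc)
          (vec (fun k : Var n => w (Sum.inl k)) i.succ)) rfl := by
    intro i
    refine det_block_eq_cauchyDet rfl (Fin.append (fun l => Sum.inl ⟨i.castSucc, l⟩)
      fun l => Sum.inr ⟨i.succ, l⟩) (append_injective (inl_mk_injective n _)
        (inr_mk_injective n _) (by simp)) ?_ ?_ ?_
    · intro x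
      constructor
      · rcases x with ⟨j, l⟩ | ⟨j, l⟩
        · intro h
          obtain rfl : j = i.castSucc := Fin.ext (by simpa [rowLabel] using h)
          exact ⟨Fin.castAdd _ l, by simp⟩
        · intro h
          obtain rfl : j = i.succ := Fin.ext (by simpa [rowLabel] using h)
          exact ⟨Fin.natAdd _ l, by simp⟩
      · rintro ⟨l, rfl⟩
        refine Fin.addCases (fun l => ?_) (fun l => ?_) l <;> simp [rowLabel]
    · intro l
      rw [append_comp_eq w]
      rfl
    · intro l
      rw [append_comp_eq σ, append_comp_eq w]
      rfl
  have hl : (Matrix.of fun x y : {x // rowLabel n (fun k : Var n => k.1) x = M + 1} =>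
      1 / (w x - w (σ y))).det
      = cauchyDet (vec (fun k : Var n => w (Sum.inl k)) (Fin.last M))
        (vec (fun k : Var n => w (Sum.inr k)) (Fin.last M)) rfl := by
    refine det_block_eq_cauchyDet rfl (fun l => Sum.inl ⟨Fin.last M, l⟩)
      (inl_mk_injective n _) ?_ (fun _ => rfl) fun _ => rfl
    rintro (⟨i, l⟩ | ⟨i, l⟩)
    · simp only [rowLabel, Sum.elim_inl, Sum.inl.injEq]
      constructor
      · intro h
        obtain rfl : i = Fin.last M := Fin.ext (by simpa using h)
        exact ⟨l, rfl⟩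
      · rintro ⟨l', h⟩
        obtain rfl : Fin.last M = i := congrArg Sigma.fst h
        rfl
    · have := i.isLt
      simp only [rowLabel, Sum.elim_inr, reduceCtorEq, exists_false, iff_false]
      omega
  rw [confDet, linkDet, det_linkMatrix_eq_prod hσ hK, hsign, prod_range_blocks, hb0, hl,
    Finset.prod_congr rfl fun i _ => hb i, hweights, integrand]
  push_cast
  rw [mul_assoc]

/-! ### Identifying the simplified integrand -/

section Hat

variable {n} (hn : Antitone n)

/-- The order of the right variables in `revConcat`. -/
def revConcatEquiv (k : Fin (M + 1) → ℕ) : Fin (∑ i : Fin (M + 1), k i.rev) ≃ Var k :=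
  finSigmaFinEquiv.symm.trans (Equiv.sigmaCongrLeft (β := fun i => Fin (k i)) Fin.revPerm)

/-- `n` extended by zero. -/
def extendZero (n : Fin (M + 1) → ℕ) (j : ℕ) : ℕ := if h : j < M + 1 then n ⟨j, h⟩ else 0

include hn in
theorem extendZero_eq_add_gap (i : Fin (M + 1)) :
    extendZero n i = extendZero n (i + 1) + gap n i := by
  refine Fin.lastCases ?_ (fun j => ?_) i
  · simp only [extendZero, Fin.val_last, lt_add_iff_pos_right, zero_lt_one, dif_pos, lt_self_iff_false,
      dif_neg, not_false_eq_true, zero_add]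
    exact gap_last n
  · have h1 : (j.castSucc : ℕ) < M + 1 := j.castSucc.isLt
    have h2 : (j.castSucc : ℕ) + 1 < M + 1 := by simp
    rw [extendZero, extendZero, dif_pos h1, dif_pos h2]
    exact gap_castSucc hn j

include hn in
theorem sum_gap_rev_castLE (q : ℕ) (hq : q ≤ M + 1) :
    ∑ i : Fin q, gap n (Fin.castLE hq i).rev = extendZero n (M + 1 - q) := by
  induction q with
  | zero => simp [extendZero]
  | succ q ih =>
    rw [Fin.sum_univ_castSucc]
    have h1 := extendZero_eq_add_gap hn (Fin.castLE hq (Fin.last q)).rev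
    have h2 : ((Fin.castLE hq (Fin.last q)).rev : ℕ) = M + 1 - (q + 1) := by simp [Fin.val_rev]
    rw [h2] at h1
    rw [h1]
    have h3 := ih (by omega)
    rw [show M + 1 - q = M + 1 - (q + 1) + 1 by omega] at h3
    rw [← h3]
    rfl

include hn in
-- In the reversed concatenation the block of level i is preceded by those of higher levels, whose
-- sizes k_j telescope to n_{i+1}.
theorem revConcatEquiv_symm_val (i : Fin (M + 1)) (l : Fin (gap n i)) :
    ((revConcatEquiv (gap n)).symm ⟨i, l⟩ : ℕ) = extendZero n (i + 1) + l := by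
  obtain ⟨i, rfl⟩ := Fin.rev_surjective i
  have h1 : (revConcatEquiv (gap n)).symm ⟨i.rev, l⟩ = finSigmaFinEquiv ⟨i, l⟩ := by
    rw [Equiv.symm_apply_eq]
    exact (congrArg (fun x : Σ i : Fin (M + 1), Fin (gap n i.rev) =>
      (⟨x.1.rev, x.2⟩ : Var (gap n))) (finSigmaFinEquiv.symm_apply_apply ⟨i, l⟩)).symm
  rw [h1, finSigmaFinEquiv_apply, sum_gap_rev_castLE hn]
  congr 2
  rw [Fin.val_rev]
  have := i.isLt
  simp only
  omega

/-- The successor of a variable: each Cauchy determinant of the simplified integrand has on its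
diagonal the pairs of a variable and its successor. -/
def hatNext : Var n ⊕ Var (gap n) → Var n ⊕ Var (gap n) :=
  Sum.elim
    (fun k => Fin.lastCases (motive := fun i => Fin (n i) → Var n ⊕ Var (gap n))
      (fun l => Sum.inr ⟨Fin.last M, Fin.cast (gap_last n) l⟩)
      (fun j l => Fin.append (fun l => Sum.inl ⟨j.succ, l⟩) (fun l => Sum.inr ⟨j.castSucc, l⟩)
        (Fin.cast (gap_castSucc hn j) l)) k.1 k.2)
    (fun v => Sum.inl ⟨0, Fin.cast (sum_gap hn) ((revConcatEquiv (gap n)).symm v)⟩)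

theorem hatNext_inl_last (l : Fin (n (Fin.last M))) :
    hatNext hn (Sum.inl ⟨Fin.last M, l⟩) = Sum.inr ⟨Fin.last M, Fin.cast (gap_last n) l⟩ := by
  simp [hatNext]

theorem hatNext_inl_castSucc (j : Fin M) (l : Fin (n j.castSucc)) :
    hatNext hn (Sum.inl ⟨j.castSucc, l⟩)
      = Fin.append (fun l => Sum.inl ⟨j.succ, l⟩) (fun l => Sum.inr ⟨j.castSucc, l⟩)
        (Fin.cast (gap_castSucc hn j) l) := by
  simp [hatNext]

theorem hatNext_surjective : Function.Surjective (hatNext hn) := by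
  rintro (⟨i, l⟩ | ⟨i, l⟩)
  · cases i using Fin.cases with
    | zero =>
      refine ⟨Sum.inr (revConcatEquiv (gap n) (Fin.cast (sum_gap hn).symm l)), ?_⟩
      simp [hatNext]
    | succ j =>
      refine ⟨Sum.inl ⟨j.castSucc, Fin.cast (gap_castSucc hn j).symm (Fin.castAdd _ l)⟩, ?_⟩
      rw [hatNext_inl_castSucc]
      simp
  · cases i using Fin.lastCases with
    | last =>
      refine ⟨Sum.inl ⟨Fin.last M, Fin.cast (gap_last n).symm l⟩, ?_⟩
      rw [hatNext_inl_last]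
      simp
    | cast j =>
      refine ⟨Sum.inl ⟨j.castSucc, Fin.cast (gap_castSucc hn j).symm (Fin.natAdd _ l)⟩, ?_⟩
      rw [hatNext_inl_castSucc]
      simp

/-- `hatNext` as a permutation. -/
noncomputable def hatPerm : Equiv.Perm (Var n ⊕ Var (gap n)) :=
  Equiv.ofBijective (hatNext hn) (Finite.surjective_iff_bijective.1 (hatNext_surjective hn))

theorem hatPerm_apply (x : Var n ⊕ Var (gap n)) : hatPerm hn x = hatNext hn x := by
  rw [hatPerm, Equiv.ofBijective_apply]

/-- The right variable in the cycle of a given variable. -/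
def hatBase : Var n ⊕ Var (gap n) → Var n ⊕ Var (gap n) :=
  Sum.elim
    (fun k => Sum.inr (revConcatEquiv (gap n)
      ⟨k.2, by rw [sum_gap hn]; exact k.2.isLt.trans_le (hn (Fin.zero_le _))⟩))
    fun v => Sum.inr v

theorem hatBase_inl_eq {k : Var n} {v : Var (gap n)}
    (h : ((revConcatEquiv (gap n)).symm v : ℕ) = k.2) : hatBase hn (Sum.inl k) = Sum.inr v := by
  rw [hatBase, Sum.elim_inl, Sum.inr.injEq, ← Equiv.eq_symm_apply]
  exact Fin.ext h.symm

theorem forall_fin_cast {p q : ℕ} (h : p = q) {P : Fin p → Prop}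
    (H : ∀ l : Fin q, P (Fin.cast h.symm l)) (l : Fin p) : P l := by
  subst h
  exact H l

/-- The position l is constant along a cycle: v̂ goes to u¹_l, then u²_l and so on, until l exceeds
the next dimension n_{i+1}. There the cycle returns to the v̂ at position l of the reversed
concatenation, the one it started from. -/
theorem hatBase_hatNext (x : Var n ⊕ Var (gap n)) :
    hatBase hn (hatNext hn x) = hatBase hn x := by
  rcases x with ⟨i, l⟩ | v
  · cases i using Fin.lastCases with
    | last =>
      rw [hatNext_inl_last]
      refine (hatBase_inl_eq hn ?_).symm
      rw [revConcatEquiv_symm_val hn]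
      simp [extendZero]
    | cast j =>
      revert l
      refine forall_fin_cast (gap_castSucc hn j) fun l => ?_
      rw [hatNext_inl_castSucc]
      refine Fin.addCases (fun l => ?_) (fun l => ?_) l
      · simp [hatBase]
      · simp only [Fin.cast_cast, Fin.cast_eq_self, Fin.append_right]
        refine (hatBase_inl_eq hn ?_).symm
        rw [revConcatEquiv_symm_val hn]
        simp only [extendZero, Fin.val_castSucc, add_lt_add_iff_right, Fin.is_lt, dif_pos,
          Fin.val_cast, Fin.val_natAdd]
        rfl
  · refine hatBase_inl_eq hn ?_
    rfl

theorem sign_hatPerm : Equiv.Perm.sign (hatPerm hn) = (-1) ^ Fintype.card (Var n) := by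
  refine sign_eq_of_height _ (hatPerm hn) (rowLabel n fun _ => 0) (hatBase hn) ?_
    (fun y => by rw [hatPerm_apply, hatBase_hatNext]) ?_ (sum_ite_rowLabel n)
  · rintro (⟨i, l⟩ | v)
    · rw [hatPerm_apply]
      cases i using Fin.lastCases with
      | last =>
        rw [hatNext_inl_last]
        simp [rowLabel]
      | cast j =>
        rw [hatNext_inl_castSucc]
        refine Fin.addCases (fun l => ?_) (fun l => ?_) (Fin.cast (gap_castSucc hn j) l) <;>
          simp [rowLabel]
    · left
      rw [hatPerm_apply]
      simp [rowLabel, hatNext]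
  · rintro (k | v)
    · simp [rowLabel]
    · intro _; rfl

/-- Each cycle of `hatPerm` contains one v̂ and rises through the levels of u, so the sign only
counts the left variables, exactly as for the original integrand. -/
theorem confDet_zero_eq (w : Var n ⊕ Var (gap n) → ℂ) :
    confDet α β n (fun _ : Var (gap n) => 0) (fun k => k.1) w
      = (-1) ^ Fintype.card (Var n) * hatIntegrand α β hn w := by
  have hσ : ∀ x, colLabel n (fun k : Var (gap n) => k.1) (hatPerm hn x)
      = rowLabel n (fun _ : Var (gap n) => 0) x := by
    rintro (⟨i, l⟩ | v)
    · rw [hatPerm_apply]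
      cases i using Fin.lastCases with
      | last =>
        rw [hatNext_inl_last]
        simp [rowLabel, colLabel]
      | cast j =>
        rw [hatNext_inl_castSucc]
        refine Fin.addCases (fun l => ?_) (fun l => ?_) (Fin.cast (gap_castSucc hn j) l) <;>
          simp [rowLabel, colLabel]
    · rw [hatPerm_apply]
      simp [rowLabel, colLabel, hatNext]
  have hK : ∀ x, rowLabel n (fun _ : Var (gap n) => 0) x < M + 2 := by
    rintro (k | k) <;> simp only [rowLabel, Sum.elim_inl, Sum.elim_inr, Fin.val_zero] <;> omega
  have hweights : ∏ x, confWeight α β n (fun _ : Var (gap n) => 0) (fun k => k.1) x (w x)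
      = (∏ k : Var n, F (fun _ => 1) α β k.1 (w (Sum.inl k))) /
        ∏ k : Var (gap n), f (fun _ => 1) α β k.1 (w (Sum.inr k)) := by
    rw [Fintype.prod_sum_type, div_eq_mul_inv, ← Finset.prod_inv_distrib]
    simp [confWeight, fPrev]
  have hb0 : (Matrix.of fun x y : {x // rowLabel n (fun _ : Var (gap n) => 0) x = 0} =>
      1 / (w x - w (hatPerm hn y))).det
      = cauchyDet (revConcat fun k : Var (gap n) => w (Sum.inr k))
        (vec (fun k : Var n => w (Sum.inl k)) 0) (sum_gap hn) := by
    refine det_block_eq_cauchyDet _ (fun j => Sum.inr (revConcatEquiv (gap n) j))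
      (Sum.inr_injective.comp (Equiv.injective _)) ?_ (fun _ => rfl) fun j => ?_
    · rintro (k | v)
      · simp [rowLabel]
      · simp only [rowLabel, Sum.elim_inr, Sum.inr.injEq]
        exact ⟨fun _ => ⟨(revConcatEquiv (gap n)).symm v, by simp⟩, fun _ => rfl⟩
    · rw [hatPerm_apply]
      simp [hatNext, vec]
  have hb : ∀ i : Fin M,
      (Matrix.of fun x y : {x // rowLabel n (fun _ : Var (gap n) => 0) x = (i : ℕ) + 1} =>
        1 / (w x - w (hatPerm hn y))).det
      = cauchyDet (vec (fun k : Var n => w (Sum.inl k)) i.castSucc)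
        (Fin.append (vec (fun k : Var n => w (Sum.inl k)) i.succ)
          (vec (fun k : Var (gap n) => w (Sum.inr k)) i.castSucc)) (gap_castSucc hn i) := by
    intro i
    refine det_block_eq_cauchyDet _ (fun l => Sum.inl ⟨i.castSucc, l⟩) (inl_mk_injective n _) ?_
      (fun _ => rfl) fun l => ?_
    · rintro (⟨j, l⟩ | v)
      · simp only [rowLabel, Sum.elim_inl, Sum.inl.injEq]
        constructor
        · intro h
          obtain rfl : j = i.castSucc := Fin.ext (by simpa using h)
          exact ⟨l, rfl⟩
        · rintro ⟨l', h⟩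
          obtain rfl : i.castSucc = j := congrArg Sigma.fst h
          rfl
      · simp [rowLabel]
    · rw [hatPerm_apply]
      rw [hatNext_inl_castSucc, append_comp_eq w]
      rfl
  have hl : (Matrix.of fun x y : {x // rowLabel n (fun _ : Var (gap n) => 0) x = M + 1} =>
      1 / (w x - w (hatPerm hn y))).det
      = cauchyDet (vec (fun k : Var n => w (Sum.inl k)) (Fin.last M))
        (vec (fun k : Var (gap n) => w (Sum.inr k)) (Fin.last M)) (gap_last n) := by
    refine det_block_eq_cauchyDet _ (fun l => Sum.inl ⟨Fin.last M, l⟩) (inl_mk_injective n _) ?_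
      (fun _ => rfl) fun l => ?_
    · rintro (⟨j, l⟩ | v)
      · simp only [rowLabel, Sum.elim_inl, Sum.inl.injEq]
        constructor
        · intro h
          obtain rfl : j = Fin.last M := Fin.ext (by simpa using h)
          exact ⟨l, rfl⟩
        · rintro ⟨l', h⟩
          obtain rfl : Fin.last M = j := congrArg Sigma.fst h
          rfl
      · simp [rowLabel]
    · rw [hatPerm_apply]
      rw [hatNext_inl_last]
      rfl
  rw [confDet, linkDet, det_linkMatrix_eq_prod hσ hK, sign_hatPerm, prod_range_blocks, hb0, hl,
    Finset.prod_congr rfl fun i _ => hb i, hweights, hatIntegrand]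
  push_cast
  rw [mul_assoc]

end Hat

end Integrands

/-! ### Contour integrals of the two integrands -/

section ContourIntegrals

variable {M : ℕ} (Γ : ContourSystem M) {α : Fin (M + 1) → ℝ} (β : Fin (M + 1) → ℝ)
  (n : Fin (M + 1) → ℕ)

theorem pulledBack_const_mul {ι : Type} [Fintype ι] (γ : ι → ℝ → ℂ) (c : ℂ) (g : (ι → ℂ) → ℂ) :
    pulledBack γ (fun w => c * g w) = fun t => c * pulledBack γ g t := by
  funext t
  simp only [pulledBack]
  ring

theorem contourInt_const_mul {ι : Type} [Fintype ι] (γ : ι → ℝ → ℂ) (c : ℂ) (g : (ι → ℂ) → ℂ) :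
    contourInt γ (fun w => c * g w) = c * contourInt γ g := by
  rw [contourInt, pulledBack_const_mul, integral_const_mul, contourInt]

theorem ContourIntegrable.const_mul {ι : Type} [Fintype ι] {γ : ι → ℝ → ℂ} {g : (ι → ℂ) → ℂ}
    (h : ContourIntegrable γ g) (c : ℂ) : ContourIntegrable γ (fun w => c * g w) := by
  rw [ContourIntegrable, pulledBack_const_mul]
  exact Integrable.const_mul h c

theorem neg_one_pow_mul_self (N : ℕ) (z : ℂ) : (-1) ^ N * ((-1) ^ N * z) = z := by
  rw [← mul_assoc, ← mul_pow]
  simp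

theorem integrand_eq (α : Fin (M + 1) → ℝ) :
    integrand (fun _ => 1) α β n = fun w => (-1) ^ Fintype.card (Var n) *
      confDet α β n (fun k : Var n => k.1) (fun k => k.1) w := by
  funext w
  rw [confDet_fst_eq, neg_one_pow_mul_self]

theorem hatIntegrand_eq (α : Fin (M + 1) → ℝ) {n : Fin (M + 1) → ℕ} (hn : Antitone n) :
    hatIntegrand α β hn = fun w => (-1) ^ Fintype.card (Var n) *
      confDet α β n (fun _ : Var (gap n) => 0) (fun k => k.1) w := by
  funext w
  rw [confDet_zero_eq α β hn, neg_one_pow_mul_self]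

theorem contourInt_integrand (α : Fin (M + 1) → ℝ) (a b : Var n → Bool) :
    contourInt (Γ.choice a b) (integrand (fun _ => 1) α β n)
      = (-1) ^ Fintype.card (Var n) * confInt Γ α β n a b (fun k : Var n => k.1) fun k => k.1 := by
  rw [integrand_eq, contourInt_const_mul]
  rfl

theorem contourIntegrable_integrand (hα : StrictMono α) (a b : Var n → Bool) :
    ContourIntegrable (Γ.choice a b) (integrand (fun _ => 1) α β n) := by
  rw [integrand_eq]
  exact (contourIntegrable_confDet Γ α β n hα a b fun _ => le_rfl).const_mul _

/-- Among the right variables on `in` contours one of maximal level is integrated first: any right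
variable of higher level is then on an `out` contour, hence on its left. -/
theorem contourInt_integrand_eq_zero (hα : StrictMono α) (a : Var n → Bool) {b : Var n → Bool}
    {k : Var n} (hk : k.1 ≠ 0) (hb : b k = true) :
    contourInt (Γ.choice a b) (integrand (fun _ => 1) α β n) = 0 := by
  obtain ⟨k₀, hk₀, hmax⟩ := Finset.exists_max_image
    (Finset.univ.filter fun k : Var n => b k = true) (fun k => k.1)
    ⟨k, Finset.mem_filter.2 ⟨Finset.mem_univ _, hb⟩⟩
  have hb₀ : b k₀ = true := (Finset.mem_filter.1 hk₀).2
  have h0 : k₀.1 ≠ 0 := fun h =>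
    hk (Fin.le_zero_iff.1 (h ▸ hmax k (Finset.mem_filter.2 ⟨Finset.mem_univ _, hb⟩)))
  let e := Equiv.optionSubtypeNe k₀
  have hnone : e none = k₀ := by simp [e]
  rw [contourInt_integrand, confInt_reindex Γ α β n e, mul_eq_zero]
  right
  refine confInt_eq_zero Γ β n hα a ?_ ?_ fun s hs => ?_
  · rw [Function.comp, hnone, hb₀]
  · rwa [Function.comp, hnone]
  · simp only [Function.comp, hnone] at hs ⊢
    by_contra hne
    exact absurd hs (not_lt.2 (hmax _ (Finset.mem_filter.2
      ⟨Finset.mem_univ _, by simpa using hne⟩)))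

/-- At the lowest level both superscripts name the same contour. -/
theorem choice_congr (a : Var n → Bool) {b b' : Var n → Bool}
    (h : ∀ k : Var n, k.1 ≠ 0 → b k = b' k) : Γ.choice a b = Γ.choice a b' := by
  funext x
  rcases x with k | k
  · rfl
  · by_cases hk : k.1 = 0
    · have hpos : ∀ c c' : Bool, pos c (0 : Fin (M + 1)) = pos c' 0 := by
        intro c c'
        cases c <;> cases c' <;> simp [pos]
      change Γ.R (pos (b k) k.1) = Γ.R (pos (b' k) k.1)
      rw [hk, hpos]
    · change Γ.right (b k) k.1 = Γ.right (b' k) k.1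
      rw [h k hk]

end ContourIntegrals

/-! ### Integrals over tori -/

section Torus

variable {M : ℕ}

theorem torusIntegral_prod (h : Fin M → ℂ → ℂ) (r : Fin M → ℝ) :
    torusIntegral (fun z => ∏ i, h i (z i)) 0 r = ∏ i, ∮ z in C(0, r i), h i z := by
  have hset : Set.Icc (0 : Fin M → ℝ) (fun _ => 2 * Real.pi)
      = Set.univ.pi fun _ => Set.Icc 0 (2 * Real.pi) := by
    rw [Set.pi_univ_Icc]
    rfl
  rw [torusIntegral, hset, volume_pi, Measure.restrict_pi_pi]
  have hprod : ∀ θ : Fin M → ℝ, (∏ i, r i * Complex.exp (θ i * Complex.I) * Complex.I : ℂ) •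
      ∏ i, h i (torusMap 0 r θ i) = ∏ i, (r i * Complex.exp (θ i * Complex.I) * Complex.I : ℂ) *
        h i (r i * Complex.exp (θ i * Complex.I)) := by
    intro θ
    rw [smul_eq_mul, ← Finset.prod_mul_distrib]
    simp [torusMap]
  simp only [hprod]
  refine (integral_fintype_prod_eq_prod (𝕜 := ℂ) (E := fun _ : Fin M => ℝ)
    (μ := fun _ => volume.restrict (Set.Icc 0 (2 * Real.pi)))
    fun i x => (r i * Complex.exp (x * Complex.I) * Complex.I : ℂ) *
      h i (r i * Complex.exp (x * Complex.I))).trans ?_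
  refine Finset.prod_congr rfl fun i _ => ?_
  rw [circleIntegral, intervalIntegral.integral_of_le Real.two_pi_pos.le,
    integral_Icc_eq_integral_Ioc]
  simp [circleMap]

theorem torusIntegrable_prod {h : Fin M → ℂ → ℂ} {r : Fin M → ℝ}
    (hc : ∀ i, Continuous fun θ : ℝ => h i (r i * Complex.exp (θ * Complex.I))) :
    TorusIntegrable (fun z => ∏ i, h i (z i)) 0 r := by
  refine Continuous.integrableOn_Icc ?_
  refine continuous_finsetProd _ fun i _ => ?_
  have := (hc i).comp (continuous_apply i : Continuous fun θ : Fin M → ℝ => θ i)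
  simpa [torusMap, Function.comp_def] using this

/-- The coefficient of the `in` or `out` contour, as a function of one variable. -/
noncomputable def coeff (b : Bool) (ζ : ℂ) : ℂ := if b then 1 / (1 - ζ) else -(ζ / (1 - ζ))

/-- The dependence on one of the variables `z_i` of a summand of the integrand of `D̂`. -/
noncomputable def levelFactor (p : ℕ) {q : ℕ} (a : Fin q → Bool) (ζ : ℂ) : ℂ :=
  (1 - ζ) ^ p * (1 - ζ⁻¹) ^ q * (∏ l, coeff (a l) ζ) * coeff false ζ ^ q *
    (1 / (2 * Real.pi * Complex.I * ζ * (1 - ζ)))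

theorem differentiableOn_coeff (b : Bool) : DifferentiableOn ℂ (coeff b) {ζ | 1 - ζ ≠ 0} := by
  intro ζ hζ
  refine DifferentiableAt.differentiableWithinAt ?_
  unfold coeff
  cases b
  · simp only [Bool.false_eq_true, if_false]
    exact (differentiableAt_id.div (by fun_prop) hζ).neg
  · simp only [if_true]
    exact (differentiableAt_const _).div (by fun_prop) hζ

theorem one_sub_ne_zero_of_norm_le {ζ : ℂ} {r : ℝ} (hr : r < 1) (h : ‖ζ‖ ≤ r) : 1 - ζ ≠ 0 := by
  intro h0
  rw [← sub_eq_zero.1 h0, norm_one] at h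
  linarith

theorem norm_mul_exp {r : ℝ} (hr : 0 < r) (θ : ℝ) : ‖(r * Complex.exp (θ * Complex.I) : ℂ)‖ = r := by
  rw [norm_mul, Complex.norm_exp_ofReal_mul_I, mul_one, Complex.norm_real, Real.norm_of_nonneg hr.le]

theorem continuous_levelFactor {r : ℝ} (hr : 0 < r ∧ r < 1) (p : ℕ) {q : ℕ} (a : Fin q → Bool) :
    Continuous fun θ : ℝ => levelFactor p a (r * Complex.exp (θ * Complex.I)) := by
  have hc : Continuous fun θ : ℝ => (r * Complex.exp (θ * Complex.I) : ℂ) := by fun_prop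
  have h1 : ∀ θ : ℝ, (1 - r * Complex.exp (θ * Complex.I) : ℂ) ≠ 0 := fun θ =>
    one_sub_ne_zero_of_norm_le hr.2 (norm_mul_exp hr.1 θ).le
  have h0 : ∀ θ : ℝ, (r * Complex.exp (θ * Complex.I) : ℂ) ≠ 0 := fun θ h => by
    have := norm_mul_exp hr.1 θ
    rw [h, norm_zero] at this
    exact hr.1.ne this
  have hco : ∀ b, Continuous fun θ : ℝ => coeff b (r * Complex.exp (θ * Complex.I)) := fun b =>
    (differentiableOn_coeff b).continuousOn.comp_continuous hc h1
  unfold levelFactor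
  refine ((((continuous_const.sub hc).pow p).mul
    ((continuous_const.sub (hc.inv₀ h0)).pow q)).mul
      (continuous_finsetProd _ fun l _ => hco (a l))).mul ((hco false).pow q) |>.mul
      (continuous_const.div ((continuous_const.mul hc).mul (continuous_const.sub hc)) fun θ => ?_)
  exact mul_ne_zero (mul_ne_zero Complex.two_pi_I_ne_zero (h0 θ)) (h1 θ)

/-- The q coefficients of the `out` contours of v cancel (1 - ζ⁻¹)^q, leaving 1/(2πiζ) times a
function holomorphic on the closed disc. Its value at 0 is 1 if every u-contour of this level is
`in`, and 0 otherwise. -/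
theorem circleIntegral_levelFactor {r : ℝ} (hr : 0 < r ∧ r < 1) (p : ℕ) {q : ℕ}
    (a : Fin q → Bool) :
    (∮ ζ in C(0, r), levelFactor p a ζ) = ∏ l, if a l then 1 else 0 := by
  have hne : ∀ ζ ∈ Metric.closedBall (0 : ℂ) r, 1 - ζ ≠ 0 := fun ζ hζ =>
    one_sub_ne_zero_of_norm_le hr.2 (by simpa using hζ)
  have hd : DifferentiableOn ℂ (fun ζ => (1 - ζ) ^ p * (1 - ζ)⁻¹ * ∏ l, coeff (a l) ζ)
      (Metric.closedBall 0 r) := by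
    refine DifferentiableOn.mul (DifferentiableOn.mul (by fun_prop)
      (DifferentiableOn.inv (by fun_prop) hne)) ?_
    exact DifferentiableOn.fun_finsetProd fun l _ => (differentiableOn_coeff (a l)).mono hne
  have h1 := hd.circleIntegral_sub_inv_smul (Metric.mem_ball_self hr.1)
  have h2 : (∮ ζ in C(0, r), levelFactor p a ζ) = ∮ ζ in C(0, r),
      (2 * Real.pi * Complex.I : ℂ)⁻¹ • ((ζ - 0)⁻¹ •
        ((1 - ζ) ^ p * (1 - ζ)⁻¹ * ∏ l, coeff (a l) ζ)) := by
    refine circleIntegral.integral_congr hr.1.le fun ζ hζ => ?_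
    have hζ1 := hne ζ (Metric.sphere_subset_closedBall hζ)
    have hζ0 : ζ ≠ 0 := Metric.ne_of_mem_sphere hζ hr.1.ne'
    have h3 : (1 - ζ⁻¹) * coeff false ζ = 1 := by
      simp only [coeff, Bool.false_eq_true, if_false]
      field_simp
      ring
    calc levelFactor p a ζ = ((1 - ζ⁻¹) * coeff false ζ) ^ q * ((1 - ζ) ^ p *
          (∏ l, coeff (a l) ζ) * (1 / (2 * Real.pi * Complex.I * ζ * (1 - ζ)))) := by
          rw [levelFactor, mul_pow]
          ring
      _ = _ := by
          rw [h3, one_pow, one_mul]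
          simp only [smul_eq_mul, sub_zero, one_div, mul_inv]
          ring
  rw [h2, circleIntegral.integral_smul, h1, inv_smul_smul₀ Complex.two_pi_I_ne_zero]
  simp only [sub_zero, one_pow, inv_one, one_mul]
  refine Finset.prod_congr rfl fun l _ => ?_
  simp [coeff]

end Torus

/-! ### The z-integrals -/

section Dhat

variable {M : ℕ} (Γ : ContourSystem M) {α : Fin (M + 1) → ℝ} (β : Fin (M + 1) → ℝ)
  (n : Fin (M + 1) → ℕ)

theorem prod_weight (z : Fin M → ℂ) (a : Var n → Bool) :
    ∏ k : Var n, weight z (a k) k.1 = (∏ l, if a ⟨0, l⟩ then 1 else 0) *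
      ∏ i : Fin M, ∏ l, coeff (a ⟨i.succ, l⟩) (z i) := by
  rw [Fintype.prod_sigma, Fin.prod_univ_succ]
  rfl

/-- Only the `out` contours of the right variables contribute. -/
theorem zIntegrand_eq (hα : StrictMono α) (z : Fin M → ℂ) :
    zIntegrand Γ α β n z = ∑ a : Var n → Bool, ((∏ l, if a ⟨0, l⟩ then 1 else 0) *
      contourInt (Γ.choice a fun _ => false) (integrand (fun _ => 1) α β n)) *
        ∏ i : Fin M, levelFactor (n i.castSucc) (fun l => a ⟨i.succ, l⟩) (z i) := by
  rw [zIntegrand, D, mul_right_comm, Finset.mul_sum]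
  refine Finset.sum_congr rfl fun a _ => ?_
  -- At the lowest level the weight is 1 for `true` and 0 for `false`, so the surviving choice is
  -- `true` there and `out` elsewhere. Its contours are those of the constant choice `false`.
  rw [Finset.sum_eq_single fun k => decide (k.1 = 0)]
  · rw [choice_congr Γ n a (b := fun k => decide (k.1 = 0)) (b' := fun _ => false)
      fun k hk => by simpa using hk]
    simp only [prod_weight, levelFactor, Finset.prod_mul_distrib]
    simp [Fin.succ_ne_zero]
    ring
  · intro b _ hb
    obtain ⟨k, hk⟩ := Function.ne_iff.1 hb
    by_cases h0 : k.1 = 0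
    · have hbk : b k = false := by simpa [h0] using hk
      have : weight z (b k) k.1 = 0 := by rw [hbk, h0]; simp [weight]
      rw [Finset.prod_eq_zero (f := fun k : Var n => weight z (b k) k.1) (Finset.mem_univ k) this]
      ring
    · rw [contourInt_integrand_eq_zero Γ β n hα a h0 (by simpa [h0] using hk), mul_zero]
  · intro h
    exact absurd (Finset.mem_univ _) h

theorem torusIntegrable_term {r : Fin M → ℝ} (hr : ∀ i, 0 < r i ∧ r i < 1) (c : ℂ)
    (a : Var n → Bool) :
    TorusIntegrable (fun z => c * ∏ i : Fin M,
      levelFactor (n i.castSucc) (fun l => a ⟨i.succ, l⟩) (z i)) 0 r :=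
  Integrable.const_mul (torusIntegrable_prod (h := fun i =>
    levelFactor (n i.castSucc) (fun l => a ⟨i.succ, l⟩))
      fun i => continuous_levelFactor (hr i) _ _) c

theorem torusIntegrable_zIntegrand (hα : StrictMono α) {r : Fin M → ℝ}
    (hr : ∀ i, 0 < r i ∧ r i < 1) : TorusIntegrable (zIntegrand Γ α β n) 0 r := by
  rw [funext (zIntegrand_eq Γ β n hα)]
  exact integrable_finsetSum _ fun a _ => torusIntegrable_term n hr _ a

theorem Dhat_eq (hα : StrictMono α) {r : Fin M → ℝ} (hr : ∀ i, 0 < r i ∧ r i < 1) :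
    Dhat Γ r α β n = contourInt (Γ.choice (fun _ => true) (fun _ => false))
      (integrand (fun _ => 1) α β n) := by
  have hsum : Dhat Γ r α β n = ∑ a : Var n → Bool, ((∏ l, if a ⟨0, l⟩ then 1 else 0) *
      contourInt (Γ.choice a fun _ => false) (integrand (fun _ => 1) α β n)) *
        ∏ i : Fin M, ∏ l, if a ⟨i.succ, l⟩ then 1 else 0 := by
    rw [Dhat, funext (zIntegrand_eq Γ β n hα), torusIntegral]
    simp only [Finset.smul_sum]
    rw [integral_finsetSum]
    · refine Finset.sum_congr rfl fun a _ => ?_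
      have h1 := torusIntegral_const_mul ((∏ l, if a ⟨0, l⟩ then 1 else 0) *
        contourInt (Γ.choice a fun _ => false) (integrand (fun _ => 1) α β n))
        (fun z => ∏ i : Fin M, levelFactor (n i.castSucc) (fun l => a ⟨i.succ, l⟩) (z i)) 0 r
      rw [torusIntegral_prod (fun i => levelFactor (n i.castSucc) (fun l => a ⟨i.succ, l⟩))] at h1
      simp only [circleIntegral_levelFactor (hr _)] at h1
      exact h1
    · intro a _
      exact (torusIntegrable_term n hr _ a).function_integrable
  rw [hsum, Finset.sum_eq_single fun _ => true]
  · simp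
  · intro a _ ha
    obtain ⟨⟨i, l⟩, hk⟩ := Function.ne_iff.1 ha
    have hk' : a ⟨i, l⟩ = false := by simpa using hk
    cases i using Fin.cases with
    | zero =>
      rw [Finset.prod_eq_zero (f := fun l => if a ⟨0, l⟩ then (1 : ℂ) else 0)
        (Finset.mem_univ l) (by simp [hk'])]
      ring
    | succ i =>
      rw [Finset.prod_eq_zero (f := fun i : Fin M => ∏ l, if a ⟨i.succ, l⟩ then (1 : ℂ) else 0)
        (Finset.mem_univ i) (Finset.prod_eq_zero (Finset.mem_univ l) (by simp [hk'])), mul_zero]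
  · intro h
    exact absurd (Finset.mem_univ _) h

end Dhat

end AiryD

theorem lemma2p3 (M : ℕ) (α β : Fin (M + 1) → ℝ) (hα : StrictMono α)
    (Γ : AiryD.ContourSystem M) (r : Fin M → ℝ) (hr : ∀ i, 0 < r i ∧ r i < 1)
    (n : Fin (M + 1) → ℕ) :
    -- the integrals that define the left-hand side converge absolutely
    ((∀ a b : AiryD.Var n → Bool,
        AiryD.ContourIntegrable (Γ.choice a b) (AiryD.integrand (fun _ => 1) α β n)) ∧
      TorusIntegrable (AiryD.zIntegrand Γ α β n) 0 r) ∧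
    -- part (i)
    AiryD.Dhat Γ r α β n =
      AiryD.contourInt (Γ.choice (fun _ => true) (fun _ => false))
        (AiryD.integrand (fun _ => 1) α β n) ∧
    -- part (ii)
    (∀ hn : Antitone n,
      AiryD.ContourIntegrable (Γ.hatChoice n) (AiryD.hatIntegrand α β hn) ∧
      AiryD.Dhat Γ r α β n =
        (∏ i : Fin M, ((n i.castSucc).factorial : ℂ) / ((AiryD.gap n i.castSucc).factorial : ℂ)) *
          AiryD.contourInt (Γ.hatChoice n) (AiryD.hatIntegrand α β hn)) ∧
    (¬ Antitone n → AiryD.Dhat Γ r α β n = 0) := by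
  refine ⟨⟨AiryD.contourIntegrable_integrand Γ β n hα, AiryD.torusIntegrable_zIntegrand Γ β n hα hr⟩,
    AiryD.Dhat_eq Γ β n hα hr, fun hn => ⟨?_, ?_⟩, fun hn => ?_⟩
  · rw [AiryD.hatIntegrand_eq]
    exact (AiryD.contourIntegrable_confDet Γ α β n hα (fun _ => true) (fun _ => false)
      (fun _ => Fin.zero_le _)).const_mul _
  · rw [AiryD.Dhat_eq Γ β n hα hr, AiryD.contourInt_integrand,
      AiryD.confInt_fst_eq_of_antitone Γ β n hα hn, AiryD.hatIntegrand_eq,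
      AiryD.contourInt_const_mul, mul_left_comm]
    rfl
  · rw [AiryD.Dhat_eq Γ β n hα hr, AiryD.contourInt_integrand,
      AiryD.confInt_fst_eq_zero_of_not_antitone Γ β n hα hn, mul_zero]
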